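/- **Model.** A continuous-time joint replenishment instance $\mathcal I$ has $n\ge1$ items, a joint ordering cost $K_0>0$, and for each item $i$ an ordering cost $K_i\ge 0$ and a holding cost of $2H_i>0$ per unit of inventory and unit of time; each item has unit demand rate. A dynamic policy $\mathcal P_i$ of item $i$ consists of ordering points $0=\tau_0<\tau_1<\cdots\to\infty$ and real quantities $q_0,q_1,\dots$; it is feasible if its inventory $I(\mathcal P_i,t)=\sum_{k:\tau_k\le t}q_k-t$ is nonnegative for all $t\ge0$. With $N(\mathcal P_i,[0,t))$ the number of its orders in $[0,t)$, and $N(\mathcal P,[0,t))$ the number of time points in $[0,t)$ at which $\mathcal P=(\mathcal P_i)_i$ orders at least one item, the long-run average cost is $$F_{\mathcal I}(\mathcal P)=K_0\limsup_{t\to\infty}\frac{N(\mathcal P,[0,t))}{t}+\sum_i\limsup_{t\to\infty}\frac{K_iN(\mathcal P_i,[0,t))+2H_i\int_0^tI(\mathcal P_i,s)\,ds}{t},$$ and $\mathrm{OPT}(\mathcal I)=\inf F_{\mathcal I}(\mathcal P)$ over feasible policies. A policy for a segment $[a,b)$ starts with zero inventory, places finitely many orders of each item in $[a,b)$, and is feasible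 if the inventories stay nonnegative on $[a,b)$; its cost $F_{\mathcal I}(\mathcal P,[a,b))$ is $K_0$ times the number of joint orders, plus $K_i$ times the number of $i$-orders and $2H_i$ times the integral of the inventory of $i$ over $[a,b)$, summed over all $i$. A discrete-time instance with $T$ periods asks for feasible policies for the segment $[0,T)$ that order at integer time points only, with this cost. Put $\mathcal M=K_0+n(\max_iK_i+\max_iH_i)$, $H_{\min}=\min_iH_i$, $\ell_-=\frac{K_0}{16\mathcal M}$, $\ell_+=\frac{16\mathcal M}{\epsilon^2H_{\min}}$ and $M=\lceil 36n^3/\epsilon^6\rceil\le 37n^3/\epsilon^6$. Let $0<\epsilon\le1$. **(A)** Suppose that $\frac{\epsilon K_0}{n}\le K_i\le\frac{K_0}{\epsilon}$ for all $i$. Then there are a segment $\mathcal T=[a,b)\subseteq[0,\infty)$ with $\ell_-\le b-a\le\ell_+$ and a feasible policy $\mathcal P$ for $\mathcal T$, with zero inventory at $b$, that orders only at points of the grid $\mathcal D=\{a+k(b-a)/M: 0\le k\le M\}$, where $|\mathcal D|\le 38n^3/\epsilon^6$, such that $$\frac{F_{\mathcal I}(\mathcal P,\mathcal T)}{b-a}\le(1+31\epsilon)\,\mathrm{OPT}(\mathcal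 I).$$ **(B)** Under the same assumption, let $L=\{\ell_-(1+\epsilon)^k: 0\le k\le\lceil\log_{1+\epsilon}(\ell_+/\ell_-)\rceil\}$, so that $|L|\le\frac3\epsilon\log\frac{256\mathcal M^2}{\epsilon^2K_0H_{\min}}$. For $\ell>0$ let $\mathcal I_\ell$ be the discrete-time instance with $M$ periods, ordering costs $K_0,K_i$ and holding parameters $H_i(\ell/M)^2$. For some $\ell\in L$, $\mathcal I_\ell$ has a policy with zero final inventory whose cost divided by $\ell$ is at most $(1+\epsilon)(1+31\epsilon)\,\mathrm{OPT}(\mathcal I)$. Conversely, for every $\ell>0$ and every policy of $\mathcal I_\ell$ with cost $c$, there is a feasible dynamic policy $\mathcal Q$ with $F_{\mathcal I}(\mathcal Q)\le c/\ell$. **(C)** Let $\mathcal I$ be arbitrary, and let $\hat{\mathcal I}$ arise from it by leaving out all items with $K_i>K_0/\epsilon$ and replacing $K_i$ by $\max\{K_i,\epsilon K_0/\hat n\}$ for the $\hat n$ remaining ones. Then $\hat{\mathcal I}$ satisfies the assumption of (A) on its ordering costs, unless $\hat n=0$, in which case $\mathrm{OPT}(\hat{\mathcal I})=0$. With $T_i=\sqrt{K_i/H_i}$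 and $E=\sum_{i:K_i>K_0/\epsilon}\left(\frac{K_0+K_i}{T_i}+H_iT_i\right)$, we have $\mathrm{OPT}(\hat{\mathcal I})+E\le(1+2\epsilon)\,\mathrm{OPT}(\mathcal I)$, and for every feasible policy $\hat{\mathcal P}$ of $\hat{\mathcal I}$ there is a feasible policy $\mathcal Q$ of $\mathcal I$ with $F_{\mathcal I}(\mathcal Q)\le F_{\hat{\mathcal I}}(\hat{\mathcal P})+E$. Thus every continuous-time instance is reduced, up to a factor $1+O(\epsilon)$, to $O(\frac1\epsilon\log\frac{\mathcal M^2}{\epsilon^2K_0H_{\min}})$ discrete-time instances with $O(n^3/\epsilon^6)$ periods each (the parameters being those of $\hat{\mathcal I}$). -/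

import Mathlib

open MeasureTheory Filter

noncomputable section

namespace JointReplenishment

/-! ### Continuous-time infinite-horizon model -/

/-- Cost parameters of a joint replenishment instance with item set `ι`: the joint ordering cost
`K₀`, individual ordering costs `K i`, and holding costs `2 * H i` per unit of inventory and unit
of time.  Demand is one unit per unit of time for every item. -/
structure Inst (ι : Type*) where
  K₀ : ℝ
  K : ι → ℝ
  H : ι → ℝ

/-- Admissible parameters. -/
structure Inst.Valid {ι : Type*} (I : Inst ι) : Prop where
  K₀_pos : 0 < I.K₀
  K_nonneg : ∀ i, 0 ≤ I.K i
  H_pos : ∀ i, 0 < I.H i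

/-- A dynamic policy of a single item: ordering points `0 = τ 0 < τ 1 < ⋯ → ∞` together with
real-valued ordering quantities. -/
structure Policy where
  τ : ℕ → ℝ
  q : ℕ → ℝ
  τ_zero : τ 0 = 0
  τ_strictMono : StrictMono τ
  τ_tendsto : Tendsto τ atTop atTop

/-- Inventory level at time `t`: the total quantity ordered up to and including time `t` (finitely
many orders, as `τ k → ∞`), minus the demand `t` consumed so far. -/
def Policy.inventory (P : Policy) (t : ℝ) : ℝ :=
  (∑ᶠ k ∈ {k : ℕ | P.τ k ≤ t}, P.q k) - t

/-- All demand is met upon occurrence. -/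
def Policy.Feasible (P : Policy) : Prop :=
  ∀ t : ℝ, 0 ≤ t → 0 ≤ P.inventory t

/-- Number of orders placed in `[0, t)`. -/
def Policy.numOrders (P : Policy) (t : ℝ) : ℕ :=
  {k : ℕ | P.τ k < t}.ncard

/-- Number of joint orders in `[0, t)`: time points where at least one item is ordered. -/
def numJointOrders {ι : Type*} (P : ι → Policy) (t : ℝ) : ℕ :=
  {s : ℝ | s < t ∧ ∃ i k, (P i).τ k = s}.ncard

/-- Cost of item `i` along `[0, t)`: ordering cost plus holding cost. -/
def Inst.itemCost {ι : Type*} (I : Inst ι) (i : ι) (P : Policy) (t : ℝ) : ℝ :=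
  I.K i * P.numOrders t + 2 * I.H i * ∫ s in Set.Ico 0 t, P.inventory s

/-- Long-run average cost of item `i`.  For feasible policies the quotient is nonnegative when
`t > 0`; values are taken in `[0, ∞]` as the `limsup` may be infinite. -/
def Inst.longRunItemCost {ι : Type*} (I : Inst ι) (i : ι) (P : Policy) : ENNReal :=
  limsup (fun t : ℝ => ENNReal.ofReal (I.itemCost i P t / t)) atTop

/-- Long-run average joint ordering cost. -/
def Inst.longRunJointCost {ι : Type*} (I : Inst ι) (P : ι → Policy) : ENNReal :=
  ENNReal.ofReal I.K₀ *
    limsup (fun t : ℝ => ENNReal.ofReal ((numJointOrders P t : ℝ) / t)) atTop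

/-- Long-run average cost of a joint replenishment policy. -/
def Inst.longRunCost {ι : Type*} [Fintype ι] (I : Inst ι) (P : ι → Policy) : ENNReal :=
  I.longRunJointCost P + ∑ i, I.longRunItemCost i (P i)

/-- Optimal long-run average cost over all feasible dynamic policies; it equals the cost of
any optimal policy. -/
def Inst.opt {ι : Type*} [Fintype ι] (I : Inst ι) : ENNReal :=
  ⨅ (P : ι → Policy) (_ : ∀ i, (P i).Feasible), I.longRunCost P

/-! ### Policies on a segment -/

/-- A policy of a single item on the segment `[a, b)`, starting with no inventory: finitely many
ordering points, and the quantity ordered at each of them. -/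
structure SegPolicy (a b : ℝ) where
  orders : Finset ℝ
  q : ℝ → ℝ
  orders_mem : ∀ t ∈ orders, t ∈ Set.Ico a b

/-- Inventory level at time `t ∈ [a, b)`. -/
def SegPolicy.inventory {a b : ℝ} (P : SegPolicy a b) (t : ℝ) : ℝ :=
  (∑ s ∈ P.orders with s ≤ t, P.q s) - (t - a)

/-- All demand along `[a, b)` is met upon occurrence. -/
def SegPolicy.Feasible {a b : ℝ} (P : SegPolicy a b) : Prop :=
  ∀ t ∈ Set.Ico a b, 0 ≤ P.inventory t

/-- The inventory level that is left at the right endpoint of the segment is zero. -/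
def SegPolicy.EndsEmpty {a b : ℝ} (P : SegPolicy a b) : Prop :=
  ∑ s ∈ P.orders, P.q s = b - a

/-- Orders are placed only at points of `D`. -/
def Restricted {ι : Type*} {a b : ℝ} (D : Set ℝ) (P : ι → SegPolicy a b) : Prop :=
  ∀ i, ∀ t ∈ (P i).orders, t ∈ D

/-- Total cost along the segment `[a, b)`: joint ordering, individual ordering, holding. -/
def Inst.segCost {ι : Type*} [Fintype ι] (I : Inst ι) {a b : ℝ} (P : ι → SegPolicy a b) : ℝ :=
  I.K₀ * ((Finset.univ.biUnion fun i => (P i).orders).card : ℝ) +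
    ∑ i, (I.K i * ((P i).orders.card : ℝ) +
      2 * I.H i * ∫ t in Set.Ico a b, (P i).inventory t)

/-- The `M + 1` endpoints obtained when `[a, b]` is divided into `M` parts of equal length. -/
def grid (a b : ℝ) (M : ℕ) : Finset ℝ :=
  (Finset.range (M + 1)).image fun k : ℕ => a + (k : ℝ) * ((b - a) / M)

/-! ### Discrete-time finite-horizon model

In the discrete-time model with `T` periods, the horizon is `[0, T)` and orders are limited to
integer time points, so that a policy is a `Restricted` policy on the segment `[0, T)`. -/

/-- A joint policy for the discrete-time model with `T` periods. -/
abbrev DiscretePolicy (ι : Type*) (T : ℕ) := ι → SegPolicy 0 (T : ℝ)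

/-- Demand is met, and orders are placed at integer time points only. -/
def DiscretePolicy.Admissible {ι : Type*} {T : ℕ} (P : DiscretePolicy ι T) : Prop :=
  (∀ i, (P i).Feasible) ∧ Restricted (Set.range fun k : ℕ => (k : ℝ)) P

/-- The parameters after a change of the units of time and quantity such that a period of
length `δ` gets length one (and demand stays one unit per unit of time). -/
def Inst.discretize {ι : Type*} (I : Inst ι) (δ : ℝ) : Inst ι where
  K₀ := I.K₀
  K := I.K
  H := fun i => I.H i * δ ^ 2

/-! ### Quantities of the reduction -/

/-- No item is expensive (`K i > K₀ / ε`) or cheap (`K i < ε K₀ / n`). -/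
def Inst.Regular {ι : Type*} [Fintype ι] (I : Inst ι) (ε : ℝ) : Prop :=
  ∀ i, ε * I.K₀ / Fintype.card ι ≤ I.K i ∧ I.K i ≤ I.K₀ / ε

/-- `K₀ + n (K_max + H_max)`. -/
def Inst.bigM {ι : Type*} [Fintype ι] (I : Inst ι) : ℝ :=
  I.K₀ + Fintype.card ι * ((⨆ i, I.K i) + ⨆ i, I.H i)

/-- `H_min`. -/
def Inst.Hmin {ι : Type*} (I : Inst ι) : ℝ := ⨅ i, I.H i

/-- Lower end of the range of segment lengths. -/
def Inst.lenLower {ι : Type*} [Fintype ι] (I : Inst ι) : ℝ := I.K₀ / (16 * I.bigM)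

/-- Upper end of the range of segment lengths. -/
def Inst.lenUpper {ι : Type*} [Fintype ι] (I : Inst ι) (ε : ℝ) : ℝ :=
  16 * I.bigM / (ε ^ 2 * I.Hmin)

/-- Number of periods for `n` items. -/
def numPeriods (n : ℕ) (ε : ℝ) : ℕ := ⌈36 * (n : ℝ) ^ 3 / ε ^ 6⌉₊

/-- Candidates for the segment length: the geometric sequence of ratio `1 + ε` that starts at the
lower end of the range and continues until it reaches the upper end. -/
def Inst.candidates {ι : Type*} [Fintype ι] (I : Inst ι) (ε : ℝ) : Finset ℝ :=
  (Finset.range (⌈Real.logb (1 + ε) (I.lenUpper ε / I.lenLower)⌉₊ + 1)).image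
    fun k : ℕ => I.lenLower * (1 + ε) ^ k

/-- Items that are not expensive. -/
abbrev Inst.Kept {ι : Type*} (I : Inst ι) (ε : ℝ) : Type _ := {i : ι // I.K i ≤ I.K₀ / ε}

/-- The instance in which expensive items are left out, and the ordering cost of cheap items is
raised to the threshold `ε K₀ / n` (with `n` the number of remaining items). -/
def Inst.reduced {ι : Type*} [Fintype ι] (I : Inst ι) (ε : ℝ) : Inst (I.Kept ε) where
  K₀ := I.K₀
  K := fun i => max (I.K i) (ε * I.K₀ / Fintype.card (I.Kept ε))
  H := fun i => I.H i

/-- Long-run average cost of ordering every expensive item on its own, at its economic order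
interval `T = √(K i / H i)`, where each of these orders also pays `K₀`. -/
def Inst.expensiveCost {ι : Type*} [Fintype ι] (I : Inst ι) (ε : ℝ) : ℝ :=
  ∑ i with I.K₀ / ε < I.K i,
    ((I.K₀ + I.K i) / √(I.K i / I.H i) + I.H i * √(I.K i / I.H i))

end JointReplenishment

end

open JointReplenishment

open MeasureTheory Filter

noncomputable section

namespace JointReplenishment

/-! ### Auxiliary facts on limits superior, integrals and counting -/

/-! Write `S` for the sum of all `K i` and `v` for the optimal cost.

Segment. Cutting a near-optimal dynamic policy at the ends of a segment of length `L` costs one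
extra order of all items, that is `K₀ + S`. The choice `L = (K₀ + S) / (ε v)` makes this an
`ε`-fraction of `v L`. By averaging, some window of length `L` costs the policy at most `(1 + ε) v
L` (`Inst.exists_window`). Inside a window, any feasible inventory is at least the demand until the
next order or the end of the window; so zero-inventory ordering at the start and at the same points
holds no more stock than the original policy.

Grid. All ordering points are rounded down by one common map to a grid of width `L / M`. Joint
orders stay joint, demand stays covered, and the holding integral `D` of an item grows by at most
`L² / M` (`integral_nextOrder_sub_le_of_shift`). By Cauchy-Schwarz, `L² ≤ 2 N D` if the item has `N`
orders (`sq_le_mul_integral_nextOrder_sub`). As no item is cheap, `N ≤ 6 n² / ε³`, so the chosen `M`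
gives `L² / M ≤ ε D`. The bounds on `L` follow from bounds on `v`: ordering everything at unit
intervals from above, the economic order quantity bound from below.

Discrete time. Stretching time by a factor in `[1, 1 + ε]` does not raise ordering cost per unit of
time and raises holding cost per unit of time by at most that factor, so a geometric set of lengths
suffices (`Inst.exists_discrete_policy`). Conversely, a discrete policy is repeated forever
(`Inst.exists_longRunCost_le`).

Preprocessing. An expensive item may pay `K₀` by itself, since `K₀ ≤ ε K i` and its own cost is at
least the economic order quantity bound. Raising cheap ordering costs adds at most `ε K₀ / n` per
item and joint order, hence at most `ε K₀` per joint order (`Inst.reduced_opt_add_le`). -/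

theorem limsup_add_le_ennreal {α : Type*} {f : Filter α} (u v : α → ENNReal) :
    limsup (fun x => u x + v x) f ≤ limsup u f + limsup v f := by
  refine ENNReal.le_of_forall_pos_le_add fun e he hlt => ?_
  have hu : limsup u f ≠ ⊤ := fun h => by simp [h] at hlt
  have hv : limsup v f ≠ ⊤ := fun h => by simp [h] at hlt
  have he2 : (e / 2 : ENNReal) ≠ 0 := by simpa using he.ne'
  have h1 := eventually_lt_of_limsup_lt (ENNReal.lt_add_right hu he2)
  have h2 := eventually_lt_of_limsup_lt (ENNReal.lt_add_right hv he2)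
  refine limsup_le_of_le (by isBoundedDefault) ?_
  filter_upwards [h1, h2] with x hx hy
  calc u x + v x ≤ (limsup u f + e / 2) + (limsup v f + e / 2) := add_le_add hx.le hy.le
    _ = limsup u f + limsup v f + (e / 2 + e / 2) := by ring
    _ = _ := by rw [ENNReal.add_halves]

theorem limsup_sum_le_ennreal {α κ : Type*} {f : Filter α} (s : Finset κ)
    (u : κ → α → ENNReal) :
    limsup (fun x => ∑ i ∈ s, u i x) f ≤ ∑ i ∈ s, limsup (u i) f := by
  classical
  induction s using Finset.induction_on with
  | empty =>
    simp only [Finset.sum_empty]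
    exact limsup_le_of_le (by isBoundedDefault) (by simp)
  | insert a s ha ih =>
    simp only [Finset.sum_insert ha]
    exact (limsup_add_le_ennreal _ _).trans (by gcongr)

theorem ofReal_sum_le_sum_ofReal {κ : Type*} (s : Finset κ) (x : κ → ℝ) :
    ENNReal.ofReal (∑ i ∈ s, x i) ≤ ∑ i ∈ s, ENNReal.ofReal (x i) := by
  classical
  induction s using Finset.induction_on with
  | empty => simp
  | insert a s ha ih =>
    simp only [Finset.sum_insert ha]
    exact ENNReal.ofReal_add_le.trans (by gcongr)

/-- A quantity that grows by at most `c` in each period of length `l` has long-run average at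
most `c / l`. -/
theorem limsup_ofReal_div_le {X : ℝ → ℝ} {c l : ℝ} (hl : 0 < l) (hc : 0 ≤ c)
    (h : ∀ t, 0 < t → X t ≤ ⌈t / l⌉₊ * c) :
    limsup (fun t : ℝ => ENNReal.ofReal (X t / t)) atTop ≤ ENNReal.ofReal (c / l) := by
  have h1 : Tendsto (fun t : ℝ => ENNReal.ofReal (c / l + c / t)) atTop
      (nhds (ENNReal.ofReal (c / l))) := by
    refine ENNReal.tendsto_ofReal ?_
    simpa using (tendsto_const_nhds (x := c / l)).add (tendsto_const_nhds.div_atTop tendsto_id)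
  rw [← h1.limsup_eq]
  refine limsup_le_limsup ?_ (by isBoundedDefault) (by isBoundedDefault)
  filter_upwards [eventually_gt_atTop 0] with t ht
  refine ENNReal.ofReal_le_ofReal ?_
  rw [div_le_iff₀ ht]
  have h2 : (⌈t / l⌉₊ : ℝ) ≤ t / l + 1 := (Nat.ceil_lt_add_one (by positivity)).le
  calc X t ≤ ⌈t / l⌉₊ * c := h t ht
    _ ≤ (t / l + 1) * c := by gcongr
    _ = (c / l + c / t) * t := by field_simp

theorem setIntegral_Ico_eq {f : ℝ → ℝ} {a b : ℝ} (hab : a ≤ b) :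
    ∫ t in Set.Ico a b, f t = ∫ t in a..b, f t := by
  rw [integral_Ico_eq_integral_Ioc, intervalIntegral.integral_of_le hab]

theorem intervalIntegrable_iff_Ico {f : ℝ → ℝ} {a b : ℝ} (hab : a ≤ b) :
    IntervalIntegrable f volume a b ↔ IntegrableOn f (Set.Ico a b) := by
  rw [intervalIntegrable_iff_integrableOn_Ioc_of_le hab, integrableOn_Ico_iff_integrableOn_Ioo,
    integrableOn_Ioc_iff_integrableOn_Ioo]

theorem integral_Ico_add {f : ℝ → ℝ} {a b c : ℝ} (hab : a ≤ b) (hbc : b ≤ c)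
    (hf : IntegrableOn f (Set.Ico a c)) :
    ∫ t in Set.Ico a c, f t = (∫ t in Set.Ico a b, f t) + ∫ t in Set.Ico b c, f t := by
  rw [setIntegral_Ico_eq hab, setIntegral_Ico_eq hbc, setIntegral_Ico_eq (hab.trans hbc),
    intervalIntegral.integral_add_adjacent_intervals]
  · exact (intervalIntegrable_iff_Ico hab).2 (hf.mono_set (Set.Ico_subset_Ico_right hbc))
  · exact (intervalIntegrable_iff_Ico hbc).2 (hf.mono_set (Set.Ico_subset_Ico_left hab))

theorem integrableOn_step {κ : Type*} (F : Finset κ) (τ q : κ → ℝ) (c a b : ℝ) :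
    IntegrableOn (fun s => (∑ k ∈ F with τ k ≤ s, q k) - (s - c)) (Set.Ico a b) := by
  simp only [Finset.sum_filter]
  refine Integrable.sub (integrable_finsetSum _ fun k _ => ?_) ?_
  · have : (fun s => if τ k ≤ s then q k else 0) = (Set.Ici (τ k)).indicator fun _ => q k := by
      ext s; simp [Set.indicator]
    rw [this]
    refine Integrable.indicator ?_ measurableSet_Ici
    exact integrable_const _
  · exact ((continuous_id.sub continuous_const).integrableOn_Icc).mono_set Set.Ico_subset_Icc_self

/-- The number of points of `A` before `a` and those of a finite set of points of `A` in `[a, b)`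
add up to at most the number of points before `b`. -/
theorem ncard_add_card_le {A : Set ℝ} {a b : ℝ} (hab : a ≤ b) (O : Finset ℝ)
    (hO : ∀ x ∈ O, x ∈ A ∧ a ≤ x ∧ x < b) (hfin : {s : ℝ | s < b ∧ s ∈ A}.Finite) :
    {s : ℝ | s < a ∧ s ∈ A}.ncard + O.card ≤ {s : ℝ | s < b ∧ s ∈ A}.ncard := by
  have hsub : {s : ℝ | s < a ∧ s ∈ A} ⊆ {s : ℝ | s < b ∧ s ∈ A} :=
    fun s hs => ⟨hs.1.trans_le hab, hs.2⟩
  rw [← Set.ncard_coe_finset O, ← Set.ncard_union_eq ?_ (hfin.subset hsub) O.finite_toSet]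
  · refine Set.ncard_le_ncard (Set.union_subset hsub fun x hx => ?_) hfin
    exact ⟨(hO x hx).2.2, (hO x hx).1⟩
  · rw [Set.disjoint_left]
    intro x hx hx'
    exact absurd hx.1 (not_lt.2 (hO x hx').2.1)

/-! ### Basic properties of policies -/

theorem Policy.finite_le (P : Policy) (t : ℝ) : {k : ℕ | P.τ k ≤ t}.Finite := by
  have h := P.τ_tendsto.eventually_gt_atTop t
  rw [← Nat.cofinite_eq_atTop, eventually_cofinite] at h
  simpa using h

theorem Policy.exists_index (P : Policy) {t : ℝ} (ht : 0 ≤ t) :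
    ∃ m, P.τ m ≤ t ∧ t < P.τ (m + 1) := by
  classical
  have hex : ∃ k, t < P.τ k := (P.τ_tendsto.eventually_gt_atTop t).exists
  obtain ⟨m, hm⟩ : ∃ m, Nat.find hex = m + 1 := by
    refine Nat.exists_eq_succ_of_ne_zero fun h0 => ?_
    have := Nat.find_spec hex
    rw [h0, P.τ_zero] at this
    linarith
  exact ⟨m, not_lt.1 (Nat.find_min hex (m := m) (by omega)), hm ▸ Nat.find_spec hex⟩

theorem Policy.numOrders_eq (P : Policy) (t : ℝ) :
    P.numOrders t = {s : ℝ | s < t ∧ s ∈ Set.range P.τ}.ncard := by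
  rw [Policy.numOrders, ← Set.ncard_image_of_injective _ P.τ_strictMono.injective]
  congr 1
  ext s
  constructor
  · rintro ⟨k, hk, rfl⟩
    exact ⟨hk, k, rfl⟩
  · rintro ⟨h, k, rfl⟩
    exact ⟨k, h, rfl⟩

theorem numJointOrders_eq {ι : Type*} (P : ι → Policy) (t : ℝ) :
    numJointOrders P t = {s : ℝ | s < t ∧ s ∈ ⋃ i, Set.range (P i).τ}.ncard := by
  simp [numJointOrders]

theorem Policy.finite_points (P : Policy) (t : ℝ) :
    {s : ℝ | s < t ∧ s ∈ Set.range P.τ}.Finite := by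
  refine ((P.finite_le t).image P.τ).subset ?_
  rintro s ⟨h, k, rfl⟩
  exact ⟨k, h.le, rfl⟩

/-- `Set.ncard` is zero on infinite sets, so comparisons of order counts by inclusion need this
finiteness. -/
theorem finite_joint_points {ι : Type*} [Finite ι] (P : ι → Policy) (t : ℝ) :
    {s : ℝ | s < t ∧ s ∈ ⋃ i, Set.range (P i).τ}.Finite := by
  refine (Set.finite_iUnion fun i => (P i).finite_points t).subset ?_
  rintro s ⟨h, hs⟩
  obtain ⟨i, hi⟩ := Set.mem_iUnion.1 hs
  exact Set.mem_iUnion.2 ⟨i, h, hi⟩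

theorem Policy.numOrders_le_numJointOrders {ι : Type*} [Finite ι] (P : ι → Policy) (i : ι)
    (t : ℝ) : (P i).numOrders t ≤ numJointOrders P t := by
  rw [Policy.numOrders_eq, numJointOrders_eq]
  exact Set.ncard_le_ncard (fun s hs => ⟨hs.1, Set.mem_iUnion.2 ⟨i, hs.2⟩⟩)
    (finite_joint_points P t)

theorem Policy.inventory_eq_sub (P : Policy) {s t : ℝ} (hst : s ≤ t)
    (h : ∀ k, s < P.τ k → t < P.τ k) : P.inventory t = P.inventory s - (t - s) := by
  have : {k : ℕ | P.τ k ≤ t} = {k : ℕ | P.τ k ≤ s} := by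
    ext k
    refine ⟨fun hk => ?_, fun hk => le_trans hk hst⟩
    exact not_lt.1 fun hlt => absurd (h k hlt) (not_lt.2 hk)
  simp only [Policy.inventory, this]
  ring

theorem Policy.integrableOn_inventory (P : Policy) (a b : ℝ) :
    IntegrableOn P.inventory (Set.Ico a b) := by
  refine (integrableOn_step (P.finite_le b).toFinset P.τ P.q 0 a b).congr_fun ?_ measurableSet_Ico
  intro s hs
  have hset : (P.finite_le s).toFinset = (P.finite_le b).toFinset.filter (P.τ · ≤ s) := by
    ext k
    simp only [Set.Finite.mem_toFinset, Finset.mem_filter, Set.mem_ofPred_eq]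
    exact ⟨fun h => ⟨h.trans hs.2.le, h⟩, fun h => h.2⟩
  simp only [Policy.inventory]
  rw [finsum_mem_eq_finite_toFinset_sum _ (P.finite_le s), hset, sub_zero]

theorem SegPolicy.integrableOn_inventory {a b : ℝ} (P : SegPolicy a b) :
    IntegrableOn P.inventory (Set.Ico a b) :=
  integrableOn_step P.orders id P.q a a b

theorem SegPolicy.inventory_eq_sub {a b : ℝ} (P : SegPolicy a b) {s t : ℝ} (hst : s ≤ t)
    (h : ∀ x ∈ P.orders, s < x → t < x) : P.inventory t = P.inventory s - (t - s) := by
  have : P.orders.filter (· ≤ t) = P.orders.filter (· ≤ s) := by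
    refine Finset.filter_congr fun x hx => ⟨fun hxt => ?_, fun hxs => hxs.trans hst⟩
    exact not_lt.1 fun hlt => absurd (h x hx hlt) (not_lt.2 hxt)
  simp only [SegPolicy.inventory, this]
  ring

theorem Inst.itemCost_nonneg {ι : Type*} {I : Inst ι} (hI : I.Valid) (i : ι) {P : Policy}
    (hP : P.Feasible) (t : ℝ) : 0 ≤ I.itemCost i P t := by
  have h1 : 0 ≤ ∫ s in Set.Ico 0 t, P.inventory s :=
    setIntegral_nonneg measurableSet_Ico fun s hs => hP s hs.1
  have := hI.K_nonneg i
  have := (hI.H_pos i).le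
  unfold Inst.itemCost
  positivity

/-! ### The next ordering point and zero-inventory ordering on a segment -/

/-- The first point of `O` after `s`, or `b` if this comes first. -/
def nextOrder (O : Finset ℝ) (b s : ℝ) : ℝ :=
  (insert b (O.filter (s < ·))).min' (Finset.insert_nonempty _ _)

/-- Identities for `nextOrder` are proved below by comparing the sets of lower bounds through this
equivalence. -/
theorem le_nextOrder_iff {O : Finset ℝ} {b s c : ℝ} :
    c ≤ nextOrder O b s ↔ c ≤ b ∧ ∀ x ∈ O, s < x → c ≤ x := by
  simp [nextOrder, Finset.le_min'_iff]

theorem nextOrder_le {O : Finset ℝ} {b s : ℝ} : nextOrder O b s ≤ b :=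
  (le_nextOrder_iff.1 le_rfl).1

theorem nextOrder_le_of_mem {O : Finset ℝ} {b s x : ℝ} (hx : x ∈ O) (h : s < x) :
    nextOrder O b s ≤ x :=
  (le_nextOrder_iff.1 le_rfl).2 x hx h

theorem le_nextOrder {O : Finset ℝ} {b s : ℝ} (h : s ≤ b) : s ≤ nextOrder O b s :=
  le_nextOrder_iff.2 ⟨h, fun _ _ hx => hx.le⟩

theorem monotone_nextOrder (O : Finset ℝ) (b : ℝ) : Monotone (nextOrder O b) := fun _ _ h =>
  le_nextOrder_iff.2 ⟨nextOrder_le, fun _ hx hlt => nextOrder_le_of_mem hx (h.trans_lt hlt)⟩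

theorem nextOrder_empty (b s : ℝ) : nextOrder ∅ b s = b :=
  le_antisymm nextOrder_le (le_nextOrder_iff.2 ⟨le_rfl, by simp⟩)

/-- To the left of a point `x`, that point takes over the role of the right endpoint. This drives
the inductions that remove the largest ordering point. -/
theorem nextOrder_insert_of_lt {O : Finset ℝ} {b s x : ℝ} (hb : x ≤ b) (hs : s < x) :
    nextOrder (insert x O) b s = nextOrder O x s := by
  refine eq_of_forall_le_iff fun c => ?_
  rw [le_nextOrder_iff, le_nextOrder_iff]
  simp only [Finset.mem_insert, forall_eq_or_imp]
  exact ⟨fun h => ⟨h.2.1 hs, h.2.2⟩, fun h => ⟨h.1.trans hb, fun _ => h.1, h.2⟩⟩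

theorem nextOrder_of_forall_le {O : Finset ℝ} {b s : ℝ} (h : ∀ x ∈ O, x ≤ s) :
    nextOrder O b s = b :=
  le_antisymm nextOrder_le
    (le_nextOrder_iff.2 ⟨le_rfl, fun x hx hlt => absurd hlt (not_lt.2 (h x hx))⟩)

theorem nextOrder_filter_le {O : Finset ℝ} {b s t : ℝ} (hst : s ≤ t) :
    nextOrder (O.filter (· ≤ t)) (nextOrder O b t) s = nextOrder O b s := by
  refine eq_of_forall_le_iff fun c => ?_
  rw [le_nextOrder_iff, le_nextOrder_iff, le_nextOrder_iff]
  simp only [Finset.mem_filter]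
  refine ⟨fun h => ⟨h.1.1, fun x hx hlt => ?_⟩, fun h => ⟨⟨h.1, fun x hx hlt => ?_⟩, ?_⟩⟩
  · rcases le_or_gt x t with hxt | hxt
    · exact h.2 x ⟨hx, hxt⟩ hlt
    · exact h.1.2 x hx hxt
  · exact h.2 x hx (hst.trans_lt hlt)
  · exact fun x hx hlt => h.2 x hx.1 hlt

theorem intervalIntegrable_nextOrder_sub (O : Finset ℝ) (b c d : ℝ) :
    IntervalIntegrable (fun s => nextOrder O b s - s) volume c d :=
  (monotone_nextOrder O b).intervalIntegrable.sub (monotone_id.intervalIntegrable)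

theorem sum_nextOrder_sub (O : Finset ℝ) {a b : ℝ} (hab : a < b)
    (hO : ∀ x ∈ O, a < x ∧ x < b) :
    (nextOrder O b a - a) + ∑ s ∈ O, (nextOrder O b s - s) = b - a := by
  induction O using Finset.induction_on_max generalizing b with
  | empty => simp [nextOrder_empty]
  | insert x O hx ih =>
    obtain ⟨h1, h2⟩ := hO x (Finset.mem_insert_self _ _)
    have hxO : x ∉ O := fun h => lt_irrefl _ (hx x h)
    have hnx : nextOrder (insert x O) b x = b := by
      refine nextOrder_of_forall_le fun y hy => ?_
      rcases Finset.mem_insert.1 hy with rfl | hy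
      exacts [le_rfl, (hx y hy).le]
    have := ih h1 fun y hy => ⟨(hO y (Finset.mem_insert_of_mem hy)).1, hx y hy⟩
    rw [Finset.sum_insert hxO, hnx, nextOrder_insert_of_lt h2.le h1,
      Finset.sum_congr rfl fun s hs => by rw [nextOrder_insert_of_lt h2.le (hx s hs)]]
    linarith

/-- The orders up to `t` form a complete zero-inventory scheme on `[a, nextOrder O b t)`, to which
the telescoping of `sum_nextOrder_sub` applies. -/
theorem sum_filter_nextOrder_sub (O : Finset ℝ) {a b t : ℝ} (hO : ∀ x ∈ O, a < x ∧ x < b)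
    (hat : a ≤ t) (htb : t < b) :
    (nextOrder O b a - a) + ∑ s ∈ O with s ≤ t, (nextOrder O b s - s) = nextOrder O b t - a := by
  have hlt : t < nextOrder O b t := by
    refine lt_of_le_of_ne (le_nextOrder htb.le) fun h => ?_
    have hm := Finset.min'_mem (insert b (O.filter (t < ·))) (Finset.insert_nonempty _ _)
    change nextOrder O b t ∈ _ at hm
    rw [← h] at hm
    simp [htb.ne] at hm
  have := sum_nextOrder_sub (O.filter (· ≤ t)) (hat.trans_lt hlt) fun x hx => by
    rw [Finset.mem_filter] at hx
    exact ⟨(hO x hx.1).1, hx.2.trans_lt hlt⟩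
  rw [nextOrder_filter_le hat, Finset.sum_congr rfl fun s hs => by
    rw [nextOrder_filter_le (Finset.mem_filter.1 hs).2]] at this
  exact this

/-- The integral is a sum of triangles `g² / 2` over the gaps `g`, and `g² / 2 ≥ c g - c² / 2`.
Keeping `c` free makes the bound additive over gaps; it is later taken as the mean gap
(Cauchy-Schwarz) and as the economic order interval. -/
theorem integral_nextOrder_sub_ge (O : Finset ℝ) {a b : ℝ} (hab : a ≤ b)
    (hO : ∀ x ∈ O, a < x ∧ x < b) (c : ℝ) :
    c * (b - a) - (O.card + 1) * (c ^ 2 / 2) ≤ ∫ s in a..b, (nextOrder O b s - s) := by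
  have hlin : ∀ x b : ℝ, ∫ s in x..b, (b - s) = (b - x) ^ 2 / 2 := by
    intro x b
    rw [intervalIntegral.integral_sub (by simp) (by simp)]
    simp
    ring
  induction O using Finset.induction_on_max generalizing b with
  | empty =>
    simp only [nextOrder_empty, hlin]
    simp only [Finset.card_empty, Nat.cast_zero]
    nlinarith [sq_nonneg (b - a - c)]
  | insert x O hx ih =>
    obtain ⟨h1, h2⟩ := hO x (Finset.mem_insert_self _ _)
    have hxO : x ∉ O := fun h => lt_irrefl _ (hx x h)
    have ih' := ih h1.le fun y hy => ⟨(hO y (Finset.mem_insert_of_mem hy)).1, hx y hy⟩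
    rw [← intervalIntegral.integral_add_adjacent_intervals
      (intervalIntegrable_nextOrder_sub (insert x O) b a x)
      (intervalIntegrable_nextOrder_sub (insert x O) b x b)]
    have e1 : ∫ s in a..x, (nextOrder (insert x O) b s - s) =
        ∫ s in a..x, (nextOrder O x s - s) := by
      rw [← setIntegral_Ico_eq h1.le, ← setIntegral_Ico_eq h1.le]
      refine setIntegral_congr_fun measurableSet_Ico fun s hs => ?_
      rw [nextOrder_insert_of_lt h2.le hs.2]
    have e2 : ∫ s in x..b, (nextOrder (insert x O) b s - s) = (b - x) ^ 2 / 2 := by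
      rw [← hlin]
      refine intervalIntegral.integral_congr fun s hs => ?_
      rw [Set.uIcc_of_le h2.le] at hs
      rw [nextOrder_of_forall_le]
      intro y hy
      rcases Finset.mem_insert.1 hy with rfl | hy
      exacts [hs.1, (hx y hy).le.trans hs.1]
    rw [e1, e2, Finset.card_insert_of_notMem hxO]
    push_cast
    nlinarith [sq_nonneg (b - x - c)]

theorem sq_le_mul_integral_nextOrder_sub (O : Finset ℝ) {a b : ℝ} (hab : a ≤ b)
    (hO : ∀ x ∈ O, a < x ∧ x < b) :
    (b - a) ^ 2 ≤ (O.card + 1) * (2 * ∫ s in a..b, (nextOrder O b s - s)) := by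
  have h := integral_nextOrder_sub_ge O hab hO ((b - a) / (O.card + 1))
  have hn : (0 : ℝ) < O.card + 1 := by positivity
  have : (b - a) / (O.card + 1) * (b - a) -
      (O.card + 1) * (((b - a) / (O.card + 1)) ^ 2 / 2) = (b - a) ^ 2 / (2 * (O.card + 1)) := by
    field_simp; ring
  rw [this, div_le_iff₀ (by positivity)] at h
  linarith

theorem intervalIntegral_nonpos {f : ℝ → ℝ} {a b : ℝ} (hab : a ≤ b)
    (hf : ∀ s ∈ Set.Icc a b, f s ≤ 0) : ∫ s in a..b, f s ≤ 0 := by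
  rw [intervalIntegral.integral_of_le hab]
  exact setIntegral_nonpos measurableSet_Ioc fun s hs => hf s (Set.Ioc_subset_Icc_self hs)

/-- Moving the ordering points to earlier times, by at most `d`, raises the total inventory of
zero-inventory ordering by at most `d` per unit of time. -/
theorem integral_nextOrder_sub_le_of_shift {O O' : Finset ℝ} {a b d : ℝ} (hab : a ≤ b)
    (hd : 0 ≤ d)
    (h : ∀ x ∈ O, a + d < x → ∃ y ∈ O', y ≤ x ∧ x - d ≤ y) :
    ∫ s in a..b, (nextOrder O' b s - s) ≤
      (∫ s in a..b, (nextOrder O b s - s)) + d * (b - a) := by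
  set g : ℝ → ℝ := fun s => nextOrder O b s - s with hg
  have hint : ∀ c e, IntervalIntegrable g volume c e := intervalIntegrable_nextOrder_sub O b
  have hshift : IntervalIntegrable (fun s => g (s + d)) volume a b := by
    have := (hint (a + d) (b + d)).comp_add_right d
    simpa using this
  have h1 : ∫ s in a..b, (nextOrder O' b s - s) ≤ ∫ s in a..b, (g (s + d) + d) := by
    refine intervalIntegral.integral_mono_on hab (intervalIntegrable_nextOrder_sub _ _ _ _)
      (hshift.add (by simp)) fun t ht => ?_
    -- A point of `O` after `t + d` has a partner in `O'` that is still after `t`.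
    have : nextOrder O' b t ≤ nextOrder O b (t + d) := by
      refine le_nextOrder_iff.2 ⟨nextOrder_le, fun x hx hlt => ?_⟩
      obtain ⟨y, hy, hyx, hxy⟩ := h x hx (by linarith [ht.1])
      exact (nextOrder_le_of_mem hy (by linarith)).trans hyx
    simp only [hg]
    linarith
  have h2 : ∫ s in a..b, (g (s + d) + d) = (∫ s in (a + d)..(b + d), g s) + d * (b - a) := by
    rw [intervalIntegral.integral_add hshift (by simp), intervalIntegral.integral_comp_add_right]
    simp [mul_comm]
  have h3 : (∫ s in a..(a + d), g s) + ∫ s in (a + d)..(b + d), g s =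
      (∫ s in a..b, g s) + ∫ s in b..(b + d), g s := by
    rw [intervalIntegral.integral_add_adjacent_intervals (hint _ _) (hint _ _),
      intervalIntegral.integral_add_adjacent_intervals (hint _ _) (hint _ _)]
  have h4 : ∫ s in b..(b + d), g s ≤ 0 := by
    refine intervalIntegral_nonpos (by linarith) fun s hs => ?_
    exact sub_nonpos.2 (nextOrder_le.trans hs.1)
  -- The shifted range `[a + d, b + d]` loses a part where `g ≥ 0` and gains one where `g ≤ 0`. If
  -- `d` exceeds the length of the segment, the whole shifted range lies beyond `b`.
  rcases le_or_gt (a + d) b with hadb | hadb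
  · have h5 : 0 ≤ ∫ s in a..(a + d), g s := by
      refine intervalIntegral.integral_nonneg (by linarith) fun s hs => ?_
      exact sub_nonneg.2 (le_nextOrder (hs.2.trans hadb))
    linarith
  · have h5 : 0 ≤ ∫ s in a..b, g s := by
      refine intervalIntegral.integral_nonneg hab fun s hs => ?_
      exact sub_nonneg.2 (le_nextOrder hs.2)
    have h6 : ∫ s in (a + d)..(b + d), g s ≤ 0 := by
      refine intervalIntegral_nonpos (by linarith) fun s hs => ?_
      exact sub_nonpos.2 (nextOrder_le.trans (hadb.le.trans hs.1))
    linarith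

/-- Zero-inventory ordering on `[a, b)` at `a` and the points of `O`. -/
def zeroInventory (a b : ℝ) (hab : a < b) (O : Finset ℝ) (hO : ∀ x ∈ O, a < x ∧ x < b) :
    SegPolicy a b where
  orders := insert a O
  q := fun s => nextOrder O b s - s
  orders_mem := by
    intro t ht
    rcases Finset.mem_insert.1 ht with rfl | ht
    exacts [⟨le_rfl, hab⟩, ⟨(hO t ht).1.le, (hO t ht).2⟩]

section
variable {a b : ℝ} (hab : a < b) {O : Finset ℝ} (hO : ∀ x ∈ O, a < x ∧ x < b)

theorem zeroInventory_inventory {t : ℝ} (ht : t ∈ Set.Ico a b) :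
    (zeroInventory a b hab O hO).inventory t = nextOrder O b t - t := by
  have haO : a ∉ O := fun h => lt_irrefl _ (hO a h).1
  have := sum_filter_nextOrder_sub O hO ht.1 ht.2
  simp only [SegPolicy.inventory, zeroInventory]
  rw [Finset.filter_insert, if_pos ht.1, Finset.sum_insert (by simp [haO])]
  linarith

theorem zeroInventory_feasible : (zeroInventory a b hab O hO).Feasible := fun t ht => by
  rw [zeroInventory_inventory hab hO ht]
  exact sub_nonneg.2 (le_nextOrder ht.2.le)

theorem zeroInventory_endsEmpty : (zeroInventory a b hab O hO).EndsEmpty := by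
  have haO : a ∉ O := fun h => lt_irrefl _ (hO a h).1
  simp only [SegPolicy.EndsEmpty, zeroInventory]
  rw [Finset.sum_insert haO]
  exact sum_nextOrder_sub O hab hO

theorem integral_zeroInventory :
    ∫ t in Set.Ico a b, (zeroInventory a b hab O hO).inventory t =
      ∫ t in a..b, (nextOrder O b t - t) := by
  rw [← setIntegral_Ico_eq hab.le]
  exact setIntegral_congr_fun measurableSet_Ico fun t ht => zeroInventory_inventory hab hO ht

end

/-! ### Lower bounds on the cost of an item -/

/-- The ordering points in the open interval `(a, b)`. -/
def Policy.window (P : Policy) (a b : ℝ) : Finset ℝ :=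
  ((P.finite_points b).subset
    (t := {s : ℝ | a < s ∧ s < b ∧ s ∈ Set.range P.τ}) fun _ h => h.2).toFinset

theorem Policy.mem_window {P : Policy} {a b x : ℝ} :
    x ∈ P.window a b ↔ a < x ∧ x < b ∧ x ∈ Set.range P.τ := by
  simp [Policy.window]

/-- Nothing arrives before the next order in the window, so the present stock has to cover all
demand up to it, or up to `b`. -/
theorem Policy.nextOrder_sub_le_inventory {P : Policy} (hP : P.Feasible) {a b s : ℝ}
    (ha : 0 ≤ a) (hs : s ∈ Set.Ico a b) :
    nextOrder (P.window a b) b s - s ≤ P.inventory s := by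
  -- The next ordering time is approached from the left: at that time itself the new order already
  -- counts.
  refine le_of_forall_lt_imp_le_of_dense fun c hc => ?_
  have hs0 : 0 ≤ s := ha.trans hs.1
  rcases le_or_gt 0 c with h0 | h0
  · have h1 : nextOrder (P.window a b) b s ≤ b := nextOrder_le
    have h2 : P.inventory (s + c) = P.inventory s - (s + c - s) := by
      refine P.inventory_eq_sub (by linarith) fun k hk => ?_
      rcases lt_or_ge (P.τ k) b with hb | hb
      · have := nextOrder_le_of_mem (b := b)
          (mem_window.2 ⟨hs.1.trans_lt hk, hb, k, rfl⟩ : P.τ k ∈ P.window a b) hk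
        linarith
      · linarith
    have := hP (s + c) (by linarith)
    linarith
  · exact h0.le.trans (hP s hs0)

theorem Policy.integral_nextOrder_sub_le {P : Policy} (hP : P.Feasible) {a b : ℝ}
    (ha : 0 ≤ a) (hab : a ≤ b) :
    ∫ s in a..b, (nextOrder (P.window a b) b s - s) ≤ ∫ s in Set.Ico a b, P.inventory s := by
  rw [← setIntegral_Ico_eq hab]
  exact setIntegral_mono_on ((intervalIntegrable_iff_Ico hab).1
    (intervalIntegrable_nextOrder_sub _ _ _ _)) (P.integrableOn_inventory a b) measurableSet_Ico
    fun s hs => Policy.nextOrder_sub_le_inventory hP ha hs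

theorem Policy.numOrders_eq_card_window (P : Policy) {t : ℝ} (ht : 0 < t) :
    P.numOrders t = (P.window 0 t).card + 1 := by
  have h0 : (0 : ℝ) ∉ P.window 0 t := fun h => lt_irrefl _ (mem_window.1 h).1
  rw [← Finset.card_insert_of_notMem h0, P.numOrders_eq, ← Set.ncard_coe_finset]
  congr 1
  ext s
  simp only [Finset.coe_insert, Set.mem_insert_iff, Finset.mem_coe, mem_window, Set.mem_ofPred_eq]
  constructor
  · rintro ⟨h, k, rfl⟩
    rcases Nat.eq_zero_or_pos k with rfl | hk
    · exact Or.inl P.τ_zero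
    · exact Or.inr ⟨P.τ_zero ▸ P.τ_strictMono hk, h, k, rfl⟩
  · rintro (rfl | h)
    · exact ⟨ht, 0, P.τ_zero⟩
    · exact h.2

/-- The economic order quantity bound. -/
theorem Inst.le_longRunItemCost {ι : Type*} {I : Inst ι} (hI : I.Valid) (i : ι) {P : Policy}
    (hP : P.Feasible) :
    ENNReal.ofReal (2 * I.H i * √(I.K i / I.H i)) ≤ I.longRunItemCost i P := by
  unfold Inst.longRunItemCost
  rw [← limsup_const (f := (atTop : Filter ℝ)) (ENNReal.ofReal (2 * I.H i * √(I.K i / I.H i)))]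
  refine limsup_le_limsup ?_ (by isBoundedDefault) (by isBoundedDefault)
  filter_upwards [eventually_gt_atTop 0] with t ht
  refine ENNReal.ofReal_le_ofReal ?_
  rw [le_div_iff₀ ht]
  have hH := hI.H_pos i
  set T := √(I.K i / I.H i) with hT
  have hK : I.K i = I.H i * T ^ 2 := by
    rw [hT, Real.sq_sqrt (div_nonneg (hI.K_nonneg i) hH.le)]
    field_simp
  -- With `c = T` and `K = H T²`, the terms with the number of orders cancel, leaving `2 H T t` for
  -- every `t > 0`.
  have h1 := integral_nextOrder_sub_ge (P.window 0 t) ht.le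
    (fun x hx => ⟨(Policy.mem_window.1 hx).1, (Policy.mem_window.1 hx).2.1⟩) T
  have h2 := h1.trans (Policy.integral_nextOrder_sub_le hP le_rfl ht.le)
  unfold Inst.itemCost
  rw [P.numOrders_eq_card_window ht, hK]
  push_cast
  have h3 := mul_le_mul_of_nonneg_left h2 (by positivity : (0 : ℝ) ≤ 2 * I.H i)
  nlinarith

/-! ### Repetition of a discrete-time policy -/

theorem Policy.inventory_of_q_eq_sub {P : Policy} (hq : ∀ k, P.q k = P.τ (k + 1) - P.τ k)
    {t : ℝ} {m : ℕ} (h1 : P.τ m ≤ t) (h2 : t < P.τ (m + 1)) :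
    P.inventory t = P.τ (m + 1) - t := by
  have : {k : ℕ | P.τ k ≤ t} = (Finset.range (m + 1) : Set ℕ) := by
    ext k
    simp only [Set.mem_ofPred_eq, Finset.coe_range, Set.mem_Iio]
    constructor
    · intro h
      exact P.τ_strictMono.lt_iff_lt.1 (h.trans_lt h2)
    · intro h
      exact (P.τ_strictMono.monotone (Nat.lt_succ_iff.1 h)).trans h1
  rw [Policy.inventory, this, finsum_mem_coe_finset, Finset.sum_congr rfl fun k _ => hq k,
    Finset.sum_range_sub, P.τ_zero, sub_zero]

/-- Zero-inventory ordering at the multiples `d * n` with `p n`. -/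
def latticePolicy (p : ℕ → Prop) (h0 : p 0) (hp : (Set.ofPred p).Infinite) (d : ℝ) (hd : 0 < d) :
    Policy where
  τ k := d * Nat.nth p k
  q k := d * Nat.nth p (k + 1) - d * Nat.nth p k
  τ_zero := by simp [Nat.nth_zero_of_zero h0]
  τ_strictMono := fun m n h => by
    have : (Nat.nth p m : ℝ) < Nat.nth p n := by exact_mod_cast Nat.nth_strictMono hp h
    exact mul_lt_mul_of_pos_left this hd
  τ_tendsto := (tendsto_natCast_atTop_atTop.comp
    (Nat.nth_strictMono hp).tendsto_atTop).const_mul_atTop hd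

/-- Demand before time `1 / 2` can only be served by an integer ordering point, hence by `0`. Thus
each repetition of a policy begins with its own order. -/
theorem SegPolicy.zero_mem_orders {M : ℕ} (hM : 0 < M) {P : SegPolicy 0 (M : ℝ)}
    (hP : P.Feasible) (hr : ∀ t ∈ P.orders, ∃ k : ℕ, (k : ℝ) = t) : (0 : ℝ) ∈ P.orders := by
  have hM' : (1 : ℝ) ≤ M := by exact_mod_cast hM
  have h := hP (1 / 2) ⟨by norm_num, by linarith⟩
  have hne : (P.orders.filter (· ≤ (1 / 2 : ℝ))).Nonempty := by
    by_contra hne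
    rw [Finset.not_nonempty_iff_eq_empty] at hne
    rw [SegPolicy.inventory, hne] at h
    norm_num at h
  obtain ⟨x, hx⟩ := hne
  obtain ⟨hx, hx'⟩ := Finset.mem_filter.1 hx
  obtain ⟨k, rfl⟩ := hr x hx
  have : k = 0 := by
    by_contra hk
    have : (1 : ℝ) ≤ k := by exact_mod_cast Nat.one_le_iff_ne_zero.2 hk
    linarith
  simpa [this] using hx

/-- Only the ordering points of `P` are repeated, while the quantities are reset to zero-inventory
ordering. Stock left over at `M` is therefore never accumulated, and `P` need not end empty. -/
theorem SegPolicy.exists_repeat {M : ℕ} (hM : 0 < M) {d : ℝ} (hd : 0 < d)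
    {P : SegPolicy 0 (M : ℝ)} (hP : P.Feasible)
    (hr : ∀ t ∈ P.orders, ∃ k : ℕ, (k : ℝ) = t) :
    ∃ Q : Policy, Q.Feasible ∧
      (∀ s ∈ Set.range Q.τ, ∃ j : ℕ, ∃ x ∈ P.orders, s = d * (j * M + x)) ∧
      ∀ j : ℕ, ∀ x ∈ Set.Ico (0 : ℝ) M, Q.inventory (d * (j * M + x)) ≤ d * P.inventory x := by
  classical
  set p : ℕ → Prop := fun n => ((n % M : ℕ) : ℝ) ∈ P.orders with hp
  have h0 : (0 : ℝ) ∈ P.orders := P.zero_mem_orders hM hP hr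
  have hmul : ∀ j, p (j * M) := fun j => by simp [hp, h0]
  have hinf : (Set.ofPred p).Infinite := by
    refine Set.infinite_of_injective_forall_mem (f := fun j : ℕ => j * M) ?_ hmul
    exact mul_left_injective₀ hM.ne'
  set Q := latticePolicy p (by simpa using hmul 0) hinf d hd with hQ
  have hrange : ∀ n, p n → ∃ k, Q.τ k = d * n := by
    intro n hn
    obtain ⟨k, hk⟩ : n ∈ Set.range (Nat.nth p) := by
      rw [Nat.range_nth_of_infinite hinf]; exact hn
    exact ⟨k, by simp [hQ, latticePolicy, hk]⟩
  have hinv : ∀ {t : ℝ} {m : ℕ}, Q.τ m ≤ t → t < Q.τ (m + 1) →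
      Q.inventory t = Q.τ (m + 1) - t := Policy.inventory_of_q_eq_sub fun _ => rfl
  refine ⟨Q, fun t ht => ?_, ?_, fun j x hx => ?_⟩
  · obtain ⟨m, h1, h2⟩ := Q.exists_index ht
    rw [hinv h1 h2]
    linarith
  · rintro _ ⟨k, rfl⟩
    refine ⟨Nat.nth p k / M, ((Nat.nth p k % M : ℕ) : ℝ), Nat.nth_mem_of_infinite hinf k, ?_⟩
    change d * (Nat.nth p k : ℝ) = _
    congr 1
    exact_mod_cast (Nat.div_add_mod' (Nat.nth p k) M).symm
  · have hx0 := hx.1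
    obtain ⟨m, h1, h2⟩ := Q.exists_index (t := d * (j * M + x)) (by positivity)
    rw [hinv h1 h2]
    have hno : ∀ n : ℕ, p n → d * (j * M + x) < d * n → Q.τ (m + 1) ≤ d * n := by
      intro n hn hlt
      obtain ⟨k, hk⟩ := hrange n hn
      rw [← hk] at hlt ⊢
      exact Q.τ_strictMono.monotone (Q.τ_strictMono.lt_iff_lt.1 (h1.trans_lt hlt))
    obtain ⟨y, hy⟩ : ∃ y, Q.τ (m + 1) = d * (j * M + y) :=
      ⟨Q.τ (m + 1) / d - j * M, by field_simp; ring⟩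
    rw [hy] at hno h2 ⊢
    -- The next copy starts with an order, so `Q` never buys beyond the current period.
    have hyM : y ≤ M := by
      have h := hno ((j + 1) * M) (hmul _) (by push_cast; gcongr; nlinarith [hx.2])
      have := le_of_mul_le_mul_left h hd
      push_cast at this
      linarith
    have hxy : y - x ≤ P.inventory x := by
      refine le_of_forall_lt_imp_le_of_dense fun c hc => ?_
      rcases le_or_gt 0 c with hc0 | hc0
      · have h3 : P.inventory (x + c) = P.inventory x - (x + c - x) := by
          refine P.inventory_eq_sub (by linarith) fun z hz hxz => ?_
          obtain ⟨r, rfl⟩ := hr z hz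
          have hrM : r < M := by exact_mod_cast (P.orders_mem _ hz).2
          have h4 := hno (j * M + r) (by simp [hp, Nat.mod_eq_of_lt hrM, hz])
            (by push_cast; gcongr)
          have := le_of_mul_le_mul_left h4 hd
          push_cast at this
          linarith
        have := hP (x + c) ⟨by linarith, by linarith⟩
        linarith
      · exact hc0.le.trans (hP x hx)
    calc d * (j * M + y) - d * (j * M + x) = d * (y - x) := by ring
      _ ≤ _ := by gcongr

section
variable {M : ℕ} {d : ℝ}

theorem ncard_repeated_le (hM : 0 < M) (hd : 0 < d) {A : Set ℝ} {U : Finset ℝ}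
    (hU : ∀ x ∈ U, 0 ≤ x) (hA : ∀ s ∈ A, ∃ j : ℕ, ∃ x ∈ U, s = d * (j * M + x)) (t : ℝ) :
    {s : ℝ | s < t ∧ s ∈ A}.ncard ≤ ⌈t / (d * M)⌉₊ * U.card := by
  classical
  have hM' : (0 : ℝ) < M := by exact_mod_cast hM
  have hsub : {s : ℝ | s < t ∧ s ∈ A} ⊆
      (((Finset.range ⌈t / (d * M)⌉₊) ×ˢ U).image fun z : ℕ × ℝ => d * (z.1 * M + z.2) :
        Finset ℝ) := by
    rintro s ⟨hst, hs⟩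
    obtain ⟨j, x, hx, rfl⟩ := hA s hs
    rw [Finset.mem_coe, Finset.mem_image]
    refine ⟨(j, x), Finset.mem_product.2 ⟨Finset.mem_range.2 ?_, hx⟩, rfl⟩
    rw [Nat.lt_ceil, lt_div_iff₀ (by positivity)]
    have := mul_nonneg hd.le (hU x hx)
    linarith
  calc _ ≤ _ := Set.ncard_le_ncard hsub (Finset.finite_toSet _)
    _ = _ := Set.ncard_coe_finset _
    _ ≤ _ := Finset.card_image_le
    _ = _ := by rw [Finset.card_product, Finset.card_range]

/-- Passing to whole periods is harmless as inventories are nonnegative. In each period, one factor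
`d` comes from the time scale and one from the quantity scale. -/
theorem integral_repeated_le (hM : 0 < M) (hd : 0 < d) {P : SegPolicy 0 (M : ℝ)} {Q : Policy}
    (hQ : Q.Feasible)
    (h : ∀ j : ℕ, ∀ x ∈ Set.Ico (0 : ℝ) M, Q.inventory (d * (j * M + x)) ≤ d * P.inventory x)
    {t : ℝ} (ht : 0 < t) :
    ∫ s in Set.Ico 0 t, Q.inventory s ≤
      ⌈t / (d * M)⌉₊ * (d ^ 2 * ∫ s in Set.Ico 0 (M : ℝ), P.inventory s) := by
  have hM' : (0 : ℝ) < M := by exact_mod_cast hM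
  set m := ⌈t / (d * M)⌉₊ with hm
  have htm : t ≤ m * (d * M) := by
    rw [← div_le_iff₀ (by positivity)]
    exact Nat.le_ceil _
  have hii : ∀ {a b : ℝ}, a ≤ b → IntervalIntegrable Q.inventory volume a b := fun hab =>
    (intervalIntegrable_iff_Ico hab).2 (Q.integrableOn_inventory _ _)
  have h1 : ∫ s in Set.Ico 0 t, Q.inventory s ≤ ∫ s in Set.Ico 0 (m * (d * M)), Q.inventory s := by
    refine setIntegral_mono_set (Q.integrableOn_inventory _ _) ?_
      (Set.Ico_subset_Ico_right htm).eventuallyLE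
    filter_upwards [self_mem_ae_restrict measurableSet_Ico] with s hs using hQ s hs.1
  refine h1.trans ?_
  have hsum := intervalIntegral.sum_integral_adjacent_intervals (f := Q.inventory) (n := m)
    (a := fun j : ℕ => (j : ℝ) * (d * M)) (μ := volume)
    fun k _ => hii (by push_cast; gcongr; linarith)
  rw [setIntegral_Ico_eq (by positivity)]
  simp only [Nat.cast_zero, zero_mul] at hsum
  rw [← hsum]
  have hper : ∀ j : ℕ, ∫ s in ((j : ℝ) * (d * M))..(((j + 1 : ℕ) : ℝ) * (d * M)), Q.inventory s ≤
      d ^ 2 * ∫ s in Set.Ico 0 (M : ℝ), P.inventory s := by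
    intro j
    have e := intervalIntegral.integral_comp_mul_add (a := 0) (b := (M : ℝ)) Q.inventory hd.ne'
      (d * (j * M))
    have e' : ∫ s in ((j : ℝ) * (d * M))..(((j + 1 : ℕ) : ℝ) * (d * M)), Q.inventory s =
        d * ∫ x in (0 : ℝ)..M, Q.inventory (d * x + d * (j * M)) := by
      rw [e, smul_eq_mul, mul_inv_cancel_left₀ hd.ne']
      congr 1 <;> push_cast <;> ring
    rw [e', ← setIntegral_Ico_eq hM'.le, pow_two, mul_assoc]
    refine mul_le_mul_of_nonneg_left ?_ hd.le
    rw [← integral_const_mul]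
    refine setIntegral_mono_on ?_ (P.integrableOn_inventory.const_mul d) measurableSet_Ico
      fun x hx => ?_
    · rw [← intervalIntegrable_iff_Ico hM'.le]
      have := (hii (a := (j : ℝ) * (d * M)) (b := ((j + 1 : ℕ) : ℝ) * (d * M))
        (by push_cast; gcongr; linarith)).comp_add_right (d * (j * M))
      have := this.comp_mul_left (c := d)
      convert this using 1
      · field_simp; ring
      · push_cast; field_simp; ring
    · have := h j x hx
      rwa [show d * x + d * (j * M) = d * (j * M + x) by ring]
  calc _ ≤ ∑ _j ∈ Finset.range m, d ^ 2 * ∫ s in Set.Ico 0 (M : ℝ), P.inventory s :=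
        Finset.sum_le_sum fun j _ => hper j
    _ = _ := by simp

end

theorem SegPolicy.integral_inventory_nonneg {a b : ℝ} {P : SegPolicy a b} (hP : P.Feasible) :
    0 ≤ ∫ s in Set.Ico a b, P.inventory s :=
  setIntegral_nonneg measurableSet_Ico hP

/-- Repeating a discrete-time policy with `M` periods of length `l / M` gives a dynamic policy
which costs no more. -/
theorem Inst.exists_longRunCost_le {ι : Type*} [Fintype ι] {I : Inst ι} (hI : I.Valid) {M : ℕ}
    (hM : 0 < M) {l : ℝ} (hl : 0 < l) (P : DiscretePolicy ι M) (hP : P.Admissible) :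
    ∃ Q : ι → Policy, (∀ i, (Q i).Feasible) ∧
      I.longRunCost Q ≤ ENNReal.ofReal ((I.discretize (l / M)).segCost P / l) := by
  classical
  have hM' : (0 : ℝ) < M := by exact_mod_cast hM
  set d := l / M with hd
  have hd0 : 0 < d := by positivity
  have hdl : d * M = l := by rw [hd]; field_simp
  choose Q hQ hA hinv using fun i => SegPolicy.exists_repeat hM hd0 (hP.1 i) (hP.2 i)
  refine ⟨Q, hQ, ?_⟩
  set U := Finset.univ.biUnion fun i => (P i).orders with hU
  have hjoint : limsup (fun t : ℝ => ENNReal.ofReal ((numJointOrders Q t : ℝ) / t)) atTop ≤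
      ENNReal.ofReal (U.card / l) := by
    refine limsup_ofReal_div_le hl (by positivity) fun t ht => ?_
    rw [numJointOrders_eq, ← hdl]
    refine mod_cast ncard_repeated_le hM hd0 (fun x hx => ?_) (fun s hs => ?_) t
    · obtain ⟨i, -, hi⟩ := Finset.mem_biUnion.1 hx
      exact ((P i).orders_mem x hi).1
    · obtain ⟨i, hi⟩ := Set.mem_iUnion.1 hs
      obtain ⟨j, x, hx, rfl⟩ := hA i s hi
      exact ⟨j, x, Finset.mem_biUnion.2 ⟨i, Finset.mem_univ _, hx⟩, rfl⟩
  have hK := hI.K_nonneg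
  have hH := fun i => (hI.H_pos i).le
  have hc : ∀ i, 0 ≤ I.K i * ((P i).orders.card : ℝ) +
      2 * (I.H i * d ^ 2) * ∫ t in Set.Ico 0 (M : ℝ), (P i).inventory t := fun i => by
    have := SegPolicy.integral_inventory_nonneg (hP.1 i)
    have := hK i
    have := hH i
    positivity
  have hitem : ∀ i, I.longRunItemCost i (Q i) ≤ ENNReal.ofReal ((I.K i * ((P i).orders.card : ℝ) +
      2 * (I.H i * d ^ 2) * ∫ t in Set.Ico 0 (M : ℝ), (P i).inventory t) / l) := by
    intro i
    refine limsup_ofReal_div_le hl (hc i) fun t ht => ?_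
    have h1 : ((Q i).numOrders t : ℝ) ≤ ⌈t / l⌉₊ * (P i).orders.card := by
      rw [Policy.numOrders_eq, ← hdl]
      exact mod_cast ncard_repeated_le hM hd0 (fun x hx => ((P i).orders_mem x hx).1) (hA i) t
    have h2 := integral_repeated_le hM hd0 (hQ i) (hinv i) ht
    rw [hdl] at h2
    have h3 := mul_le_mul_of_nonneg_left h1 (hK i)
    have h4 := mul_le_mul_of_nonneg_left h2 (mul_nonneg zero_le_two (hH i))
    unfold Inst.itemCost
    linarith
  have hK0 := hI.K₀_pos.le
  calc I.longRunCost Q ≤ ENNReal.ofReal I.K₀ * ENNReal.ofReal (U.card / l) +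
        ∑ i, ENNReal.ofReal ((I.K i * ((P i).orders.card : ℝ) +
          2 * (I.H i * d ^ 2) * ∫ t in Set.Ico 0 (M : ℝ), (P i).inventory t) / l) := by
        unfold Inst.longRunCost Inst.longRunJointCost
        gcongr with i
        exact hitem i
    _ = _ := by
        rw [← ENNReal.ofReal_mul hK0, ← ENNReal.ofReal_sum_of_nonneg
          fun i _ => div_nonneg (hc i) hl.le, ← ENNReal.ofReal_add (by positivity)
          (Finset.sum_nonneg fun i _ => div_nonneg (hc i) hl.le)]
        congr 1
        simp only [Inst.segCost, Inst.discretize]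
        rw [add_div, Finset.sum_div, mul_div_assoc]

/-! ### Ordering all items periodically -/

/-- This is the repetition of a discrete policy with a single period of length `T` and a single
order. -/
theorem Inst.exists_longRunCost_le_of_period {ι : Type*} [Fintype ι] [Nonempty ι] {I : Inst ι}
    (hI : I.Valid) {T : ℝ} (hT : 0 < T) :
    ∃ Q : ι → Policy, (∀ i, (Q i).Feasible) ∧
      I.longRunCost Q ≤ ENNReal.ofReal ((I.K₀ + ∑ i, (I.K i + I.H i * T ^ 2)) / T) := by
  classical
  have h01 : (0 : ℝ) < (1 : ℕ) := by norm_num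
  set Z := zeroInventory 0 ((1 : ℕ) : ℝ) h01 ∅ (by simp) with hZ
  have hords : Z.orders = {0} := rfl
  have hint : ∫ t in Set.Ico 0 ((1 : ℕ) : ℝ), Z.inventory t = 1 / 2 := by
    rw [hZ, integral_zeroInventory]
    simp only [nextOrder_empty]
    rw [intervalIntegral.integral_sub (by simp) (by simp)]
    simp
    norm_num
  obtain ⟨Q, hQ, hc⟩ := Inst.exists_longRunCost_le hI Nat.one_pos hT (fun _ : ι => Z)
    ⟨fun _ => zeroInventory_feasible h01 _, fun _ t ht => ⟨0, by simpa [hords, eq_comm] using ht⟩⟩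
  refine ⟨Q, hQ, hc.trans_eq ?_⟩
  congr 2
  have hcard : (Finset.univ.biUnion fun _ : ι => ({0} : Finset ℝ)).card = 1 := by
    rw [Finset.card_eq_one]
    exact ⟨0, by ext; simp⟩
  simp only [Inst.segCost, hcard, hint, hords, Inst.discretize, Finset.card_singleton]
  rw [Nat.cast_one, mul_one, div_one]
  congr 1
  exact Finset.sum_congr rfl fun i _ => by ring

/-- Ordering an item on its own with period `T`. -/
theorem Inst.exists_itemPolicy {ι : Type*} {I : Inst ι} (hI : I.Valid) (i : ι) {T : ℝ}
    (hT : 0 < T) :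
    ∃ Q : Policy, Q.Feasible ∧
      ENNReal.ofReal I.K₀ *
          limsup (fun t : ℝ => ENNReal.ofReal ((Q.numOrders t : ℝ) / t)) atTop +
        I.longRunItemCost i Q ≤ ENNReal.ofReal ((I.K₀ + I.K i) / T + I.H i * T) := by
  -- In an instance with one item, every order is a joint order, so the item pays `K₀` each time.
  obtain ⟨Q, hQ, hc⟩ := Inst.exists_longRunCost_le_of_period
    (I := (⟨I.K₀, fun _ => I.K i, fun _ => I.H i⟩ : Inst Unit))
    ⟨hI.K₀_pos, fun _ => hI.K_nonneg i, fun _ => hI.H_pos i⟩ hT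
  refine ⟨Q (), hQ (), le_trans (le_of_eq ?_) (hc.trans_eq ?_)⟩
  · have : ∀ t, numJointOrders Q t = (Q ()).numOrders t := fun t => by
      rw [numJointOrders_eq, Policy.numOrders_eq]
      congr 1
      ext s
      exact and_congr_right fun _ => Set.mem_iUnion.trans ⟨fun ⟨_, h⟩ => h, fun h => ⟨(), h⟩⟩
    simp only [Inst.longRunCost, Inst.longRunJointCost, this, Finset.univ_unique,
      Finset.sum_singleton]
    rfl
  · congr 1
    simp only [Finset.univ_unique, Finset.sum_singleton]
    field_simp
    ring

/-! ### Expensive and cheap items -/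

section
variable {ι : Type*} [Fintype ι] {I : Inst ι} {ε : ℝ}

theorem Inst.reduced_valid (hI : I.Valid) : (I.reduced ε).Valid where
  K₀_pos := hI.K₀_pos
  K_nonneg i := (hI.K_nonneg i).trans (le_max_left _ _)
  H_pos i := hI.H_pos i

theorem Inst.reduced_regular (hI : I.Valid) (hε : 0 < ε) (hε1 : ε ≤ 1) :
    (I.reduced ε).Regular ε := by
  intro i
  refine ⟨le_max_right _ _, max_le i.2 ?_⟩
  have hK := hI.K₀_pos
  have hn : (1 : ℝ) ≤ Fintype.card (I.Kept ε) := by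
    exact_mod_cast Fintype.card_pos_iff.2 ⟨i⟩
  change ε * I.K₀ / Fintype.card (I.Kept ε) ≤ I.K₀ / ε
  calc ε * I.K₀ / Fintype.card (I.Kept ε) ≤ ε * I.K₀ := div_le_self (by positivity) hn
    _ ≤ 1 * I.K₀ := by gcongr
    _ ≤ I.K₀ / ε := by rw [one_mul, le_div_iff₀ hε]; nlinarith

theorem Inst.sum_kept_add_sum_expensive (I : Inst ι) (ε : ℝ) (f : ι → ENNReal) :
    ∑ i : I.Kept ε, f i + ∑ i with I.K₀ / ε < I.K i, f i = ∑ i, f i := by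
  classical
  rw [← Finset.sum_filter_add_sum_filter_not Finset.univ (fun i => I.K i ≤ I.K₀ / ε) f]
  congr 1
  · exact (Finset.sum_subtype _ (by simp) f).symm
  · simp only [not_le]

/-- The expensive items are run separately at their economic intervals. Joint orders are counted by
a union bound, and kept items only become cheaper when their original ordering costs return. -/
theorem Inst.exists_extension (hI : I.Valid) (hε : 0 < ε) (P : I.Kept ε → Policy)
    (hP : ∀ i, (P i).Feasible) :
    ∃ Q : ι → Policy, (∀ i, (Q i).Feasible) ∧
      I.longRunCost Q ≤ (I.reduced ε).longRunCost P + ENNReal.ofReal (I.expensiveCost ε) := by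
  classical
  have hT : ∀ i, I.K₀ / ε < I.K i → 0 < √(I.K i / I.H i) := fun i hi =>
    Real.sqrt_pos.2 (div_pos ((div_pos hI.K₀_pos hε).trans hi) (hI.H_pos i))
  have hex : ∀ i, ∃ R : Policy, I.K₀ / ε < I.K i → R.Feasible ∧
      ENNReal.ofReal I.K₀ *
          limsup (fun t : ℝ => ENNReal.ofReal ((R.numOrders t : ℝ) / t)) atTop +
        I.longRunItemCost i R ≤
          ENNReal.ofReal ((I.K₀ + I.K i) / √(I.K i / I.H i) + I.H i * √(I.K i / I.H i)) := by
    intro i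
    by_cases hi : I.K₀ / ε < I.K i
    · obtain ⟨R, h⟩ := Inst.exists_itemPolicy hI i (hT i hi)
      exact ⟨R, fun _ => h⟩
    · obtain ⟨R, -⟩ := Inst.exists_itemPolicy hI i one_pos
      exact ⟨R, fun h => absurd h hi⟩
  choose R hR using hex
  set Q : ι → Policy := fun i => if h : I.K i ≤ I.K₀ / ε then P ⟨i, h⟩ else R i with hQ
  have hQ1 : ∀ i : I.Kept ε, Q i = P i := fun i => by simp [hQ, i.2]
  have hQ2 : ∀ i, I.K₀ / ε < I.K i → Q i = R i := fun i hi => by simp [hQ, not_le.2 hi]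
  refine ⟨Q, fun i => ?_, ?_⟩
  · rcases le_or_gt (I.K i) (I.K₀ / ε) with h | h
    · exact hQ1 ⟨i, h⟩ ▸ hP _
    · exact hQ2 i h ▸ (hR i h).1
  set X := Finset.univ.filter fun i => I.K₀ / ε < I.K i with hX
  set r : Policy → ENNReal := fun S =>
    limsup (fun t : ℝ => ENNReal.ofReal ((S.numOrders t : ℝ) / t)) atTop with hr
  have hcount : ∀ t, numJointOrders Q t ≤ numJointOrders P t + ∑ i ∈ X, (R i).numOrders t := by
    intro t
    rw [numJointOrders_eq, numJointOrders_eq,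
      Finset.sum_congr rfl fun i _ => (R i).numOrders_eq t]
    have hsub : {s : ℝ | s < t ∧ s ∈ ⋃ i, Set.range (Q i).τ} ⊆
        {s : ℝ | s < t ∧ s ∈ ⋃ i, Set.range (P i).τ} ∪
          ⋃ i ∈ X, {s : ℝ | s < t ∧ s ∈ Set.range (R i).τ} := by
      rintro s ⟨hst, hs⟩
      obtain ⟨i, hi⟩ := Set.mem_iUnion.1 hs
      rcases le_or_gt (I.K i) (I.K₀ / ε) with h | h
      · rw [hQ1 ⟨i, h⟩] at hi
        exact Or.inl ⟨hst, Set.mem_iUnion.2 ⟨_, hi⟩⟩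
      · rw [hQ2 i h] at hi
        exact Or.inr (Set.mem_biUnion (by simpa [hX] using h) ⟨hst, hi⟩)
    have hfin : (⋃ i ∈ X, {s : ℝ | s < t ∧ s ∈ Set.range (R i).τ}).Finite :=
      X.finite_toSet.biUnion fun i _ => (R i).finite_points t
    calc _ ≤ _ := Set.ncard_le_ncard hsub ((finite_joint_points P t).union hfin)
      _ ≤ _ := Set.ncard_union_le _ _
      _ ≤ _ := by
        gcongr
        exact Finset.set_ncard_biUnion_le X _
  have hjoint : I.longRunJointCost Q ≤
      (I.reduced ε).longRunJointCost P + ∑ i ∈ X, ENNReal.ofReal I.K₀ * r (R i) := by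
    rw [← Finset.mul_sum]
    unfold Inst.longRunJointCost
    change _ ≤ ENNReal.ofReal I.K₀ * _ + _
    rw [← mul_add]
    gcongr
    refine le_trans ?_ ((limsup_add_le_ennreal _ _).trans
      (add_le_add le_rfl (limsup_sum_le_ennreal X
        fun i t => ENNReal.ofReal (((R i).numOrders t : ℝ) / t))))
    refine limsup_le_limsup ?_ (by isBoundedDefault) (by isBoundedDefault)
    filter_upwards [eventually_gt_atTop 0] with t ht
    refine le_trans (ENNReal.ofReal_le_ofReal ?_) (ENNReal.ofReal_add_le.trans
      (add_le_add le_rfl (ofReal_sum_le_sum_ofReal _ _)))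
    rw [← Finset.sum_div, ← add_div]
    gcongr
    exact_mod_cast hcount t
  have hitems : ∑ i, I.longRunItemCost i (Q i) ≤
      ∑ i, (I.reduced ε).longRunItemCost i (P i) + ∑ i ∈ X, I.longRunItemCost i (R i) := by
    rw [← I.sum_kept_add_sum_expensive ε]
    refine add_le_add (Finset.sum_le_sum fun i _ => ?_) (le_of_eq ?_)
    · rw [hQ1 i]
      refine limsup_le_limsup ?_ (by isBoundedDefault) (by isBoundedDefault)
      filter_upwards [eventually_gt_atTop 0] with t ht
      refine ENNReal.ofReal_le_ofReal ?_
      unfold Inst.itemCost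
      change _ ≤ (_ + 2 * I.H i * _) / t
      gcongr
      exact le_max_left _ _
    · exact Finset.sum_congr rfl fun i hi => by rw [hQ2 i (by simpa [hX] using hi)]
  have hE : ENNReal.ofReal (I.expensiveCost ε) = ∑ i ∈ X, ENNReal.ofReal
      ((I.K₀ + I.K i) / √(I.K i / I.H i) + I.H i * √(I.K i / I.H i)) := by
    unfold Inst.expensiveCost
    refine ENNReal.ofReal_sum_of_nonneg fun i _ => ?_
    have := hI.K₀_pos
    have := hI.K_nonneg i
    have := hI.H_pos i
    positivity
  calc I.longRunCost Q ≤ ((I.reduced ε).longRunJointCost P +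
          ∑ i ∈ X, ENNReal.ofReal I.K₀ * r (R i)) +
        (∑ i, (I.reduced ε).longRunItemCost i (P i) + ∑ i ∈ X, I.longRunItemCost i (R i)) :=
        add_le_add hjoint hitems
    _ = (I.reduced ε).longRunCost P +
        ∑ i ∈ X, (ENNReal.ofReal I.K₀ * r (R i) + I.longRunItemCost i (R i)) := by
        rw [Finset.sum_add_distrib, Inst.longRunCost]
        ring
    _ ≤ _ := by
        rw [hE]
        gcongr with i hi
        exact (hR i (by simpa [hX] using hi)).2

theorem Inst.reduced_opt_add_le (hI : I.Valid) (hε : 0 < ε) :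
    (I.reduced ε).opt + ENNReal.ofReal (I.expensiveCost ε) ≤
      ENNReal.ofReal (1 + 2 * ε) * I.opt := by
  classical
  have h1ε : ENNReal.ofReal (1 + 2 * ε) ≠ 0 := by
    simp only [ne_eq, ENNReal.ofReal_eq_zero, not_le]; positivity
  unfold Inst.opt
  rw [ENNReal.mul_iInf_of_ne h1ε ENNReal.ofReal_ne_top]
  refine le_iInf fun P => ?_
  rw [ENNReal.mul_iInf_of_ne h1ε ENNReal.ofReal_ne_top]
  refine le_iInf fun hP => ?_
  refine (add_le_add (iInf₂_le (fun i : I.Kept ε => P i) fun i : I.Kept ε => hP i.1) le_rfl).trans ?_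
  set X := Finset.univ.filter fun i => I.K₀ / ε < I.K i with hX
  have hK0 := hI.K₀_pos
  set J := limsup (fun t : ℝ => ENNReal.ofReal ((numJointOrders P t : ℝ) / t)) atTop with hJ
  have hjoint : (I.reduced ε).longRunJointCost (fun i : I.Kept ε => P i) ≤
      ENNReal.ofReal I.K₀ * J := by
    unfold Inst.longRunJointCost
    change ENNReal.ofReal I.K₀ * _ ≤ _
    gcongr
    refine limsup_le_limsup ?_ (by isBoundedDefault) (by isBoundedDefault)
    filter_upwards [eventually_gt_atTop 0] with t ht
    refine ENNReal.ofReal_le_ofReal ?_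
    gcongr
    rw [numJointOrders_eq, numJointOrders_eq]
    refine Set.ncard_le_ncard ?_ (finite_joint_points P t)
    rintro s ⟨hst, hs⟩
    obtain ⟨i, hi⟩ := Set.mem_iUnion.1 hs
    exact ⟨hst, Set.mem_iUnion.2 ⟨i, hi⟩⟩
  set n := Fintype.card (I.Kept ε) with hn
  have hitem : ∀ i : I.Kept ε, (I.reduced ε).longRunItemCost i (P i) ≤
      I.longRunItemCost i (P i) + ENNReal.ofReal (ε * I.K₀ / n) * J := by
    intro i
    -- Each order of an item is charged to a joint order; summing over the `n` kept items gives `ε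
    -- K₀ J`.
    have hle : ENNReal.ofReal (ε * I.K₀ / n) *
        limsup (fun t : ℝ => ENNReal.ofReal (((P i).numOrders t : ℝ) / t)) atTop ≤
          ENNReal.ofReal (ε * I.K₀ / n) * J := by
      gcongr
      refine limsup_le_limsup ?_ (by isBoundedDefault) (by isBoundedDefault)
      filter_upwards [eventually_gt_atTop 0] with t ht
      refine ENNReal.ofReal_le_ofReal ?_
      gcongr
      exact Policy.numOrders_le_numJointOrders P i t
    refine le_trans ?_ (add_le_add le_rfl hle)
    rw [← ENNReal.limsup_const_mul_of_ne_top ENNReal.ofReal_ne_top]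
    refine le_trans ?_ (limsup_add_le_ennreal _ _)
    refine limsup_le_limsup ?_ (by isBoundedDefault) (by isBoundedDefault)
    filter_upwards [eventually_gt_atTop 0] with t ht
    rw [← ENNReal.ofReal_mul (by positivity)]
    refine le_trans (ENNReal.ofReal_le_ofReal ?_) ENNReal.ofReal_add_le
    rw [← mul_div_assoc, ← add_div]
    gcongr
    unfold Inst.itemCost
    have h1 : (I.reduced ε).K i ≤ I.K i + ε * I.K₀ / n :=
      max_le (le_add_of_nonneg_right (by positivity))
        (le_add_of_nonneg_left (hI.K_nonneg i))
    have h2 := mul_le_mul_of_nonneg_right h1 (Nat.cast_nonneg (α := ℝ) ((P i).numOrders t))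
    change _ + 2 * I.H i * _ ≤ _
    linarith
  have hsum : ∑ i : I.Kept ε, (I.reduced ε).longRunItemCost i (P i) ≤
      ∑ i : I.Kept ε, I.longRunItemCost i (P i) +
        ENNReal.ofReal ε * (ENNReal.ofReal I.K₀ * J) := by
    refine (Finset.sum_le_sum fun i _ => hitem i).trans ?_
    rw [Finset.sum_add_distrib]
    gcongr
    rw [Finset.sum_const, nsmul_eq_mul, ← mul_assoc, ← mul_assoc, ← ENNReal.ofReal_mul hε.le]
    gcongr
    rw [Finset.card_univ, ← hn, ← ENNReal.ofReal_natCast, ← ENNReal.ofReal_mul (by positivity)]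
    refine ENNReal.ofReal_le_ofReal ?_
    rcases Nat.eq_zero_or_pos n with h0 | h0
    · simp [h0]; positivity
    · exact (mul_div_cancel₀ _ (by positivity)).le
  have hexp : ENNReal.ofReal (I.expensiveCost ε) ≤
      ∑ i ∈ X, ENNReal.ofReal (1 + ε) * I.longRunItemCost i (P i) := by
    unfold Inst.expensiveCost
    refine (ofReal_sum_le_sum_ofReal _ _).trans (Finset.sum_le_sum fun i hi => ?_)
    have hi' : I.K₀ / ε < I.K i := by simpa [hX] using hi
    refine le_trans ?_ (mul_le_mul_right (Inst.le_longRunItemCost hI i (hP i)) _)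
    rw [← ENNReal.ofReal_mul (by positivity)]
    refine ENNReal.ofReal_le_ofReal ?_
    have hH := hI.H_pos i
    have hK : 0 < I.K i := (div_pos hK0 hε).trans hi'
    set T := √(I.K i / I.H i) with hT
    have hT0 : 0 < T := Real.sqrt_pos.2 (by positivity)
    have hKT : I.K i = I.H i * T ^ 2 := by
      rw [hT, Real.sq_sqrt (by positivity)]
      field_simp
    have h1 : I.K₀ ≤ ε * I.K i := by
      rw [div_lt_iff₀ hε] at hi'
      linarith
    -- At the economic interval, `K / T = H T`, and `K₀ ≤ ε K` by expensiveness.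
    have h2 : (I.K₀ + I.K i) / T ≤ (1 + ε) * (I.H i * T) := by
      rw [div_le_iff₀ hT0]
      calc I.K₀ + I.K i ≤ (1 + ε) * I.K i := by linarith
        _ = _ := by rw [hKT]; ring
    nlinarith [mul_pos hε (mul_pos hH hT0)]
  have hsplit : ∑ i, I.longRunItemCost i (P i) =
      ∑ i : I.Kept ε, I.longRunItemCost i (P i) + ∑ i ∈ X, I.longRunItemCost i (P i) :=
    (I.sum_kept_add_sum_expensive ε _).symm
  have h1 : ENNReal.ofReal (1 + ε) = 1 + ENNReal.ofReal ε := by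
    rw [ENNReal.ofReal_add zero_le_one hε.le, ENNReal.ofReal_one]
  rw [← Finset.mul_sum] at hexp
  set A := ENNReal.ofReal I.K₀ * J with hA
  set B := ∑ i : I.Kept ε, I.longRunItemCost i (P i) with hB
  set C := ∑ i ∈ X, I.longRunItemCost i (P i) with hC
  have htot : I.longRunCost P = A + (B + C) := by rw [← hsplit]; rfl
  rw [htot]
  calc (I.reduced ε).longRunCost (fun i : I.Kept ε => P i) + ENNReal.ofReal (I.expensiveCost ε)
      ≤ (A + (B + ENNReal.ofReal ε * A)) + ENNReal.ofReal (1 + ε) * C :=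
        add_le_add (add_le_add hjoint hsum) hexp
    _ ≤ (A + (B + ENNReal.ofReal ε * A)) + ENNReal.ofReal (1 + ε) * C + ENNReal.ofReal ε * B :=
        le_self_add
    _ = ENNReal.ofReal (1 + ε) * (A + (B + C)) := by rw [h1]; ring
    _ ≤ _ := by
        gcongr
        linarith

end

/-! ### Bounds on the optimal cost -/

section
variable {ι : Type*} [Fintype ι] {I : Inst ι} {ε : ℝ}

theorem Inst.le_bigM (I : Inst ι) : I.K₀ + ∑ i, (I.K i + I.H i) ≤ I.bigM := by
  unfold Inst.bigM
  have h : ∑ i, (I.K i + I.H i) ≤ ∑ _i : ι, ((⨆ i, I.K i) + ⨆ i, I.H i) :=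
    Finset.sum_le_sum fun i _ => add_le_add (le_ciSup (Finite.bddAbove_range _) i)
      (le_ciSup (Finite.bddAbove_range _) i)
  rw [Finset.sum_const, nsmul_eq_mul, Finset.card_univ] at h
  linarith

theorem Inst.add_le_bigM (hI : I.Valid) (i : ι) : I.K₀ + I.K i + I.H i ≤ I.bigM := by
  have h := Finset.single_le_sum (f := fun i => I.K i + I.H i)
    (fun j _ => add_nonneg (hI.K_nonneg j) (hI.H_pos j).le) (Finset.mem_univ i)
  have := I.le_bigM
  linarith

theorem Inst.bigM_pos (hI : I.Valid) : 0 < I.bigM := by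
  have h : 0 ≤ ∑ i, (I.K i + I.H i) :=
    Finset.sum_nonneg fun j _ => add_nonneg (hI.K_nonneg j) (hI.H_pos j).le
  linarith [I.le_bigM, hI.K₀_pos]

theorem Inst.Hmin_le (I : Inst ι) (i : ι) : I.Hmin ≤ I.H i :=
  ciInf_le (Finite.bddBelow_range _) i

theorem Inst.Hmin_pos [Nonempty ι] (hI : I.Valid) : 0 < I.Hmin := by
  obtain ⟨i, hi⟩ := exists_eq_ciInf_of_finite (f := I.H)
  rw [Inst.Hmin, ← hi]
  exact hI.H_pos i

theorem Inst.opt_le_bigM [Nonempty ι] (hI : I.Valid) : I.opt ≤ ENNReal.ofReal I.bigM := by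
  obtain ⟨Q, hQ, hc⟩ := Inst.exists_longRunCost_le_of_period hI one_pos
  refine (iInf₂_le Q hQ).trans (hc.trans (ENNReal.ofReal_le_ofReal ?_))
  simpa using I.le_bigM

/-- The economic order quantity bounds are summed, with `√(K / H) ≥ K / bigM` because `K H ≤ bigM²`.
The linear form in `K` is what the bound on the segment length needs. -/
theorem Inst.le_opt [Nonempty ι] (hI : I.Valid) :
    ENNReal.ofReal (2 * I.Hmin * (∑ i, I.K i) / I.bigM) ≤ I.opt := by
  have hM := Inst.bigM_pos hI
  refine le_iInf₂ fun P hP => ?_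
  refine le_trans ?_ (le_add_left (Finset.sum_le_sum fun i _ =>
    Inst.le_longRunItemCost hI i (hP i)))
  rw [mul_div_assoc, Finset.sum_div, Finset.mul_sum]
  refine (ofReal_sum_le_sum_ofReal _ _).trans (Finset.sum_le_sum fun i _ => ?_)
  refine ENNReal.ofReal_le_ofReal ?_
  have hH := hI.H_pos i
  have hK := hI.K_nonneg i
  have hb := Inst.add_le_bigM hI i
  have hK0 := hI.K₀_pos
  have := I.Hmin_le i
  gcongr
  refine Real.le_sqrt_of_sq_le ?_
  rw [div_pow, div_le_div_iff₀ (by positivity) hH]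
  have h1 : I.K i * I.H i ≤ I.bigM ^ 2 := by
    rw [pow_two]
    exact mul_le_mul (by linarith) (by linarith) hH.le hM.le
  nlinarith

theorem Inst.Regular.le_sum_K [Nonempty ι] (h : I.Regular ε) : ε * I.K₀ ≤ ∑ i, I.K i := by
  have hn : (0 : ℝ) < Fintype.card ι := by exact_mod_cast Fintype.card_pos
  calc ε * I.K₀ = ∑ _i : ι, ε * I.K₀ / Fintype.card ι := by
        rw [Finset.sum_const, nsmul_eq_mul, Finset.card_univ]
        field_simp
    _ ≤ _ := Finset.sum_le_sum fun i _ => (h i).1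

theorem Inst.Regular.sum_K_le (h : I.Regular ε) : ∑ i, I.K i ≤ Fintype.card ι * (I.K₀ / ε) :=
  calc ∑ i, I.K i ≤ ∑ _i : ι, I.K₀ / ε := Finset.sum_le_sum fun i _ => (h i).2
    _ = _ := by rw [Finset.sum_const, nsmul_eq_mul, Finset.card_univ]

/-! ### A segment of small average cost -/

/-- The long-run cost is a sum of separate limits superior and so dominates that of the total cost.
This gives one inequality between reals at a finite horizon. -/
theorem Inst.eventually_cost_lt {P : ι → Policy} {c : ℝ}
    (hI : I.Valid) (h : I.longRunCost P < ENNReal.ofReal c) :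
    ∀ᶠ t in atTop, I.K₀ * numJointOrders P t + ∑ i, I.itemCost i (P i) t < c * t := by
  have h1 : limsup (fun t : ℝ => ENNReal.ofReal I.K₀ *
      ENNReal.ofReal ((numJointOrders P t : ℝ) / t) +
        ∑ i, ENNReal.ofReal (I.itemCost i (P i) t / t)) atTop < ENNReal.ofReal c := by
    refine lt_of_le_of_lt ((limsup_add_le_ennreal _ _).trans (add_le_add (le_of_eq ?_)
      (limsup_sum_le_ennreal _ _))) h
    exact ENNReal.limsup_const_mul_of_ne_top ENNReal.ofReal_ne_top
  filter_upwards [eventually_lt_of_limsup_lt h1, eventually_gt_atTop 0] with t ht ht0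
  rw [← div_lt_iff₀ ht0]
  by_contra! hcon
  refine absurd ht (not_lt.2 ((ENNReal.ofReal_le_ofReal hcon).trans ?_))
  rw [add_div, Finset.sum_div, mul_div_assoc]
  refine ENNReal.ofReal_add_le.trans (add_le_add (le_of_eq ?_) (ofReal_sum_le_sum_ofReal _ _))
  exact ENNReal.ofReal_mul hI.K₀_pos.le

theorem Inst.exists_window (hI : I.Valid) {P : ι → Policy} (hP : ∀ i, (P i).Feasible) {c L : ℝ}
    (hL : 0 < L) (h : I.longRunCost P < ENNReal.ofReal c) :
    ∃ a b : ℝ, 0 ≤ a ∧ b - a = L ∧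
      I.K₀ * ((Finset.univ.biUnion fun i => (P i).window a b).card : ℝ) +
        ∑ i, (I.K i * (((P i).window a b).card : ℝ) +
          2 * I.H i * ∫ s in a..b, (nextOrder ((P i).window a b) b s - s)) ≤ c * L := by
  set G : ℝ → ℝ := fun t => I.K₀ * numJointOrders P t + ∑ i, I.itemCost i (P i) t with hG
  have hK0 := hI.K₀_pos
  obtain ⟨m, hm, hm0⟩ : ∃ m : ℕ, G (m * L) < c * (m * L) ∧ 0 < m :=
    (((tendsto_natCast_atTop_atTop.atTop_mul_const hL).eventually
      (Inst.eventually_cost_lt hI h)).and (eventually_gt_atTop 0)).exists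
  -- If every window cost more than `c L`, telescoping from `G 0 ≥ 0` would contradict `hm`.
  obtain ⟨j, hj⟩ : ∃ j : ℕ, G ((j + 1 : ℕ) * L) - G (j * L) ≤ c * L := by
    by_contra! hcon
    have h1 : ∑ j ∈ Finset.range m, c * L ≤
        ∑ j ∈ Finset.range m, (G ((j + 1 : ℕ) * L) - G (j * L)) :=
      Finset.sum_le_sum fun j _ => (hcon j).le
    rw [Finset.sum_range_sub (fun j : ℕ => G (j * L))] at h1
    have h2 : 0 ≤ G ((0 : ℕ) * L) :=
      add_nonneg (by positivity) (Finset.sum_nonneg fun i _ => Inst.itemCost_nonneg hI i (hP i) _)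
    rw [Finset.sum_const, Finset.card_range, nsmul_eq_mul] at h1
    linarith
  set a : ℝ := j * L with ha
  set b : ℝ := (j + 1 : ℕ) * L with hb
  have hba : b - a = L := by rw [hb, ha]; push_cast; ring
  have ha0 : 0 ≤ a := by positivity
  have hab : a ≤ b := by linarith
  refine ⟨a, b, ha0, hba, le_trans ?_ hj⟩
  have hjoint : (numJointOrders P a : ℝ) +
      (Finset.univ.biUnion fun i => (P i).window a b).card ≤ numJointOrders P b := by
    rw [numJointOrders_eq, numJointOrders_eq]
    refine mod_cast ncard_add_card_le hab _ (fun x hx => ?_) (finite_joint_points P b)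
    obtain ⟨i, -, hi⟩ := Finset.mem_biUnion.1 hx
    obtain ⟨h1, h2, h3⟩ := Policy.mem_window.1 hi
    exact ⟨Set.mem_iUnion.2 ⟨i, h3⟩, h1.le, h2⟩
  have hitem : ∀ i, I.K i * (((P i).window a b).card : ℝ) +
      2 * I.H i * (∫ s in a..b, (nextOrder ((P i).window a b) b s - s)) ≤
        I.itemCost i (P i) b - I.itemCost i (P i) a := by
    intro i
    have h1 : ((P i).numOrders a : ℝ) + ((P i).window a b).card ≤ (P i).numOrders b := by
      rw [Policy.numOrders_eq, Policy.numOrders_eq]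
      refine mod_cast ncard_add_card_le hab _ (fun x hx => ?_) ((P i).finite_points b)
      obtain ⟨h1, h2, h3⟩ := Policy.mem_window.1 hx
      exact ⟨h3, h1.le, h2⟩
    have h2 := Policy.integral_nextOrder_sub_le (hP i) ha0 hab
    have h3 := integral_Ico_add ha0 hab ((P i).integrableOn_inventory 0 b)
    have h4 := mul_le_mul_of_nonneg_left h1 (hI.K_nonneg i)
    have h5 := mul_le_mul_of_nonneg_left h2 (mul_nonneg zero_le_two (hI.H_pos i).le)
    unfold Inst.itemCost
    rw [h3]
    linarith
  have h1 := mul_le_mul_of_nonneg_left hjoint hK0.le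
  have h2 := Finset.sum_le_sum fun i (_ : i ∈ Finset.univ) => hitem i
  rw [Finset.sum_sub_distrib] at h2
  simp only [hG]
  linarith

/-- Rounding ordering points down to a grid, together with an order of all items at the start of
the segment. -/
theorem Inst.exists_grid_policy (hI : I.Valid) {a b : ℝ} (hab : a < b) {M : ℕ} (hM : 0 < M)
    (O : ι → Finset ℝ) (hO : ∀ i, ∀ x ∈ O i, a < x ∧ x < b) :
    ∃ P : ι → SegPolicy a b, (∀ i, (P i).Feasible) ∧ (∀ i, (P i).EndsEmpty) ∧
      Restricted (grid a b M : Set ℝ) P ∧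
      I.segCost P ≤ I.K₀ * ((Finset.univ.biUnion O).card + 1) +
        ∑ i, (I.K i * ((O i).card + 1) +
          2 * I.H i * ((∫ s in a..b, (nextOrder (O i) b s - s)) + (b - a) ^ 2 / M)) := by
  have hM' : (0 : ℝ) < M := by exact_mod_cast hM
  have hL : 0 < b - a := by linarith
  set d := (b - a) / M with hd
  have hd0 : 0 < d := by positivity
  have hdM : M * d = b - a := by rw [hd]; field_simp
  set ρ : ℝ → ℝ := fun x => a + (⌊(x - a) / d⌋₊ : ℝ) * d with hρ
  have hρa : ∀ x, a ≤ ρ x := fun x => by simp only [hρ]; linarith [(by positivity :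
    0 ≤ (⌊(x - a) / d⌋₊ : ℝ) * d)]
  have hρx : ∀ x, a ≤ x → ρ x ≤ x := fun x hx => by
    have h := Nat.floor_le (div_nonneg (sub_nonneg.2 hx) hd0.le)
    rw [le_div_iff₀ hd0] at h
    simp only [hρ]; linarith
  have hρd : ∀ x, x - d ≤ ρ x := fun x => by
    have h := Nat.lt_floor_add_one ((x - a) / d)
    rw [div_lt_iff₀ hd0] at h
    simp only [hρ]; linarith
  have hgrid : ∀ x, x < b → a ≤ x → ρ x ∈ grid a b M := fun x hx hax => by
    refine Finset.mem_image.2 ⟨⌊(x - a) / d⌋₊, Finset.mem_range.2 ?_, rfl⟩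
    have h : (⌊(x - a) / d⌋₊ : ℝ) < M := by
      refine (Nat.floor_le (div_nonneg (sub_nonneg.2 hax) hd0.le)).trans_lt ?_
      rw [div_lt_iff₀ hd0]; linarith
    have : ⌊(x - a) / d⌋₊ < M := by exact_mod_cast h
    omega
  -- `zeroInventory` adds the order at `a` itself. Only points `x ≤ a + d` can be rounded to `a`,
  -- which is why the shift lemma asks for partners beyond `a + d` only.
  set O' : ι → Finset ℝ := fun i => ((O i).image ρ).erase a with hO'def
  have hO' : ∀ i, ∀ x ∈ O' i, a < x ∧ x < b := by
    intro i y hy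
    obtain ⟨hya, hy⟩ := Finset.mem_erase.1 hy
    obtain ⟨x, hx, rfl⟩ := Finset.mem_image.1 hy
    exact ⟨lt_of_le_of_ne (hρa x) hya.symm, (hρx x (hO i x hx).1.le).trans_lt (hO i x hx).2⟩
  have hcard : ∀ i, ((zeroInventory a b hab (O' i) (hO' i)).orders.card : ℝ) ≤
      (O i).card + 1 := fun i => by
    have : (insert a (O' i)).card ≤ (O i).card + 1 :=
      (Finset.card_insert_le _ _).trans (Nat.succ_le_succ
        ((Finset.card_le_card (Finset.erase_subset _ _)).trans Finset.card_image_le))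
    exact_mod_cast this
  have hint : ∀ i, ∫ t in Set.Ico a b, (zeroInventory a b hab (O' i) (hO' i)).inventory t ≤
      (∫ s in a..b, (nextOrder (O i) b s - s)) + (b - a) ^ 2 / M := fun i => by
    rw [integral_zeroInventory]
    refine (integral_nextOrder_sub_le_of_shift (O := O i) hab.le hd0.le fun x hx hlt => ?_).trans
      (le_of_eq ?_)
    · refine ⟨ρ x, Finset.mem_erase.2 ⟨?_, Finset.mem_image_of_mem _ hx⟩,
        hρx x (hO i x hx).1.le, hρd x⟩
      have := hρd x
      exact ne_of_gt (by linarith)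
    · rw [hd]; ring
  have hjoint : ((Finset.univ.biUnion fun i =>
      (zeroInventory a b hab (O' i) (hO' i)).orders).card : ℝ) ≤
        (Finset.univ.biUnion O).card + 1 := by
    have hsub : (Finset.univ.biUnion fun i => (zeroInventory a b hab (O' i) (hO' i)).orders) ⊆
        insert a ((Finset.univ.biUnion O).image ρ) := by
      intro y hy
      obtain ⟨i, -, hi⟩ := Finset.mem_biUnion.1 hy
      rcases Finset.mem_insert.1 hi with rfl | hi
      · exact Finset.mem_insert_self _ _
      · obtain ⟨x, hx, rfl⟩ := Finset.mem_image.1 (Finset.mem_of_mem_erase hi)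
        exact Finset.mem_insert_of_mem (Finset.mem_image_of_mem _
          (Finset.mem_biUnion.2 ⟨i, Finset.mem_univ _, hx⟩))
    have := (Finset.card_le_card hsub).trans ((Finset.card_insert_le _ _).trans
      (Nat.succ_le_succ Finset.card_image_le))
    exact_mod_cast this
  refine ⟨fun i => zeroInventory a b hab (O' i) (hO' i), fun i => zeroInventory_feasible _ _,
    fun i => zeroInventory_endsEmpty _ _, fun i t ht => ?_, ?_⟩
  · rcases Finset.mem_insert.1 ht with rfl | ht
    · exact Finset.mem_coe.2 (Finset.mem_image.2 ⟨0, by simp, by simp⟩)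
    · obtain ⟨x, hx, rfl⟩ := Finset.mem_image.1 (Finset.mem_of_mem_erase ht)
      exact hgrid x (hO i x hx).2 (hO i x hx).1.le
  · unfold Inst.segCost
    have hK0 := hI.K₀_pos.le
    have hK := hI.K_nonneg
    have hH := fun i => (hI.H_pos i).le
    refine add_le_add (mul_le_mul_of_nonneg_left hjoint hK0) (Finset.sum_le_sum fun i _ => ?_)
    exact add_le_add (mul_le_mul_of_nonneg_left (hcard i) (hK i))
      (mul_le_mul_of_nonneg_left (hint i) (mul_nonneg zero_le_two (hH i)))

end

/-! ### The number of periods and the cheap grid policy on a segment -/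

section
variable {ι : Type*} [Fintype ι] {I : Inst ι} {ε : ℝ}

theorem one_le_pow_div_pow {n : ℕ} (hn : 0 < n) (hε : 0 < ε) (hε1 : ε ≤ 1) :
    1 ≤ (n : ℝ) ^ 3 / ε ^ 6 := by
  have hn' : (1 : ℝ) ≤ n := by exact_mod_cast hn
  rw [le_div_iff₀ (by positivity), one_mul]
  exact (pow_le_one₀ hε.le hε1).trans (one_le_pow₀ hn')

theorem numPeriods_le {n : ℕ} (hn : 0 < n) (hε : 0 < ε) (hε1 : ε ≤ 1) :
    (numPeriods n ε : ℝ) ≤ 37 * (n : ℝ) ^ 3 / ε ^ 6 := by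
  have h1 := one_le_pow_div_pow hn hε hε1
  have h2 : (numPeriods n ε : ℝ) < 36 * (n : ℝ) ^ 3 / ε ^ 6 + 1 :=
    Nat.ceil_lt_add_one (by positivity)
  rw [mul_div_assoc] at h2 ⊢
  linarith

theorem numPeriods_pos {n : ℕ} (hn : 0 < n) (hε : 0 < ε) : 0 < numPeriods n ε :=
  Nat.ceil_pos.2 (by positivity)

theorem card_grid_le {n : ℕ} (hn : 0 < n) (hε : 0 < ε) (hε1 : ε ≤ 1) (a b : ℝ) :
    ((grid a b (numPeriods n ε)).card : ℝ) ≤ 38 * (n : ℝ) ^ 3 / ε ^ 6 := by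
  have h1 := one_le_pow_div_pow hn hε hε1
  have h2 := numPeriods_le hn hε hε1
  have h3 : ((grid a b (numPeriods n ε)).card : ℝ) ≤ numPeriods n ε + 1 := by
    have : (grid a b (numPeriods n ε)).card ≤ numPeriods n ε + 1 :=
      Finset.card_image_le.trans_eq (Finset.card_range _)
    exact_mod_cast this
  rw [mul_div_assoc] at h2 ⊢
  linarith

/-- The existence of a segment of admissible length and of a cheap policy which orders at grid
points only. -/
theorem Inst.exists_segment [Nonempty ι] (hI : I.Valid) (hε : 0 < ε) (hε1 : ε ≤ 1)
    (hreg : I.Regular ε) :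
    ∃ a b : ℝ, 0 ≤ a ∧ a < b ∧ I.lenLower ≤ b - a ∧ b - a ≤ I.lenUpper ε ∧
      ∃ P : ι → SegPolicy a b, (∀ i, (P i).Feasible) ∧ (∀ i, (P i).EndsEmpty) ∧
        Restricted (grid a b (numPeriods (Fintype.card ι) ε) : Set ℝ) P ∧
        ENNReal.ofReal (I.segCost P / (b - a)) ≤ ENNReal.ofReal (1 + 31 * ε) * I.opt := by
  have hn : 0 < Fintype.card ι := Fintype.card_pos
  set n := Fintype.card ι with hndef
  have hn1 : (1 : ℝ) ≤ n := by exact_mod_cast hn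
  set M := numPeriods n ε with hM
  have hM0 : 0 < M := numPeriods_pos hn hε
  have hM0' : (0 : ℝ) < M := by exact_mod_cast hM0
  have hK0 := hI.K₀_pos
  have hB := Inst.bigM_pos hI
  have hHm := Inst.Hmin_pos hI
  have hK := hI.K_nonneg
  set S := ∑ i, I.K i with hS
  have hS1 : ε * I.K₀ ≤ S := hreg.le_sum_K
  have hS2 : S ≤ n * (I.K₀ / ε) := hreg.sum_K_le
  have hS0 : 0 < S := lt_of_lt_of_le (by positivity) hS1
  have htop : I.opt ≠ ⊤ := ne_top_of_le_ne_top ENNReal.ofReal_ne_top (Inst.opt_le_bigM hI)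
  obtain ⟨v, hv0, hv⟩ : ∃ v : ℝ, 0 ≤ v ∧ I.opt = ENNReal.ofReal v :=
    ⟨I.opt.toReal, ENNReal.toReal_nonneg, (ENNReal.ofReal_toReal htop).symm⟩
  have hvB : v ≤ I.bigM := by
    have := Inst.opt_le_bigM hI
    rwa [hv, ENNReal.ofReal_le_ofReal_iff hB.le] at this
  have hvL : 2 * I.Hmin * S / I.bigM ≤ v := by
    have := Inst.le_opt hI
    rwa [hv, ENNReal.ofReal_le_ofReal_iff hv0] at this
  have hvpos : 0 < v := lt_of_lt_of_le (by positivity) hvL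
  -- This length makes one extra order of all items cost exactly `ε v L`.
  set L := (I.K₀ + S) / (ε * v) with hLdef
  have hL : 0 < L := by positivity
  have hLv : ε * (v * L) = I.K₀ + S := by rw [hLdef]; field_simp
  obtain ⟨P, hP, hPc⟩ : ∃ P : ι → Policy, (∀ i, (P i).Feasible) ∧
      I.longRunCost P < ENNReal.ofReal ((1 + ε) * v) := by
    have : I.opt < ENNReal.ofReal ((1 + ε) * v) := by
      rw [hv, ENNReal.ofReal_lt_ofReal_iff (by positivity)]
      nlinarith
    simpa only [Inst.opt, iInf_lt_iff, exists_prop] using this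
  obtain ⟨a, b, ha, hba, hw⟩ := Inst.exists_window hI hP hL hPc
  have hab : a < b := by linarith
  set O : ι → Finset ℝ := fun i => (P i).window a b with hOdef
  have hO : ∀ i, ∀ x ∈ O i, a < x ∧ x < b := fun i x hx =>
    ⟨(Policy.mem_window.1 hx).1, (Policy.mem_window.1 hx).2.1⟩
  obtain ⟨R, hR1, hR2, hR3, hR4⟩ := Inst.exists_grid_policy hI hab hM0 O hO
  refine ⟨a, b, ha, hab, ?_, ?_, R, hR1, hR2, hR3, ?_⟩
  · rw [hba, Inst.lenLower, hLdef, div_le_div_iff₀ (by positivity) (by positivity)]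
    have h1 : ε * v ≤ 1 * I.bigM := mul_le_mul hε1 hvB hv0 zero_le_one
    calc I.K₀ * (ε * v) ≤ (I.K₀ + S) * (1 * I.bigM) :=
          mul_le_mul (by linarith) h1 (by positivity) (by positivity)
      _ ≤ (I.K₀ + S) * (16 * I.bigM) := by gcongr; norm_num
  · rw [hba, Inst.lenUpper, hLdef, div_le_div_iff₀ (by positivity) (by positivity)]
    rw [div_le_iff₀ hB] at hvL
    -- As no item is cheap, `ε K₀ ≤ S`; then `hvL` turns `Hmin * S` into `v * bigM`.
    have h1 : ε * (I.K₀ + S) ≤ 2 * S := by nlinarith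
    calc (I.K₀ + S) * (ε ^ 2 * I.Hmin) = ε * (ε * (I.K₀ + S)) * I.Hmin := by ring
      _ ≤ ε * (2 * S) * I.Hmin := by gcongr
      _ = ε * (2 * I.Hmin * S) := by ring
      _ ≤ ε * (v * I.bigM) := by gcongr
      _ ≤ 16 * I.bigM * (ε * v) := by nlinarith [mul_pos hε (mul_pos hvpos hB)]
  · rw [hv, ← ENNReal.ofReal_mul (by positivity)]
    refine ENNReal.ofReal_le_ofReal ?_
    rw [div_le_iff₀ (by linarith), hba]
    set D : ι → ℝ := fun i => ∫ s in a..b, (nextOrder (O i) b s - s) with hD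
    have hsq : ∀ i, L ^ 2 ≤ ((O i).card + 1) * (2 * D i) := fun i => by
      rw [← hba]
      exact sq_le_mul_integral_nextOrder_sub (O i) hab.le (hO i)
    have hD0 : ∀ i, 0 ≤ D i := fun i => by
      by_contra! hneg
      have h1 : (((O i).card : ℝ) + 1) * (2 * D i) < 0 :=
        mul_neg_of_pos_of_neg (by positivity) (by linarith)
      nlinarith [hsq i]
    set C := I.K₀ * (((Finset.univ.biUnion O).card : ℝ) + 1) +
      ∑ i, (I.K i * ((O i).card + 1) + 2 * I.H i * D i) with hC
    -- One `ε` stems from the near-optimality of `P`, the other from the order of all items at `a`.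
    have hCle : C ≤ (1 + 2 * ε) * (v * L) := by
      have e : C = (I.K₀ * ((Finset.univ.biUnion O).card : ℝ) +
          ∑ i, (I.K i * ((O i).card : ℝ) + 2 * I.H i * D i)) + (I.K₀ + S) := by
        have : ∑ i, (I.K i * (((O i).card : ℝ) + 1) + 2 * I.H i * D i) =
            ∑ i, (I.K i * ((O i).card : ℝ) + 2 * I.H i * D i) + S := by
          rw [hS, ← Finset.sum_add_distrib]
          exact Finset.sum_congr rfl fun i _ => by ring
        rw [hC, this]
        ring
      rw [e, ← hLv]
      linarith
    have hterm : ∀ i, 0 ≤ I.K i * (((O i).card : ℝ) + 1) + 2 * I.H i * D i := fun i => by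
      have := hK i
      have := (hI.H_pos i).le
      have := hD0 i
      positivity
    -- Each order of `i` costs at least `ε K₀ / n`, while the total is `C ≤ 3 v L ≤ 6 n K₀ / ε²`.
    have hN : ∀ i, ((O i).card : ℝ) + 1 ≤ 6 * n ^ 2 / ε ^ 3 := fun i => by
      have h1 : I.K i * ((O i).card + 1) ≤ C := by
        have h2 := Finset.single_le_sum (fun j _ => hterm j) (Finset.mem_univ i)
        have h3 : 0 ≤ I.K₀ * (((Finset.univ.biUnion O).card : ℝ) + 1) := by positivity
        have h4 : 0 ≤ 2 * I.H i * D i :=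
          mul_nonneg (mul_nonneg zero_le_two (hI.H_pos i).le) (hD0 i)
        rw [hC]
        linarith
      have h2 : ε * I.K₀ / n * ((O i).card + 1) ≤ C :=
        le_trans (mul_le_mul_of_nonneg_right (hreg i).1 (by positivity)) h1
      have h3 : C ≤ 6 * n * I.K₀ / ε ^ 2 := by
        have h4 : I.K₀ + S ≤ 2 * n * I.K₀ / ε := by
          have : I.K₀ ≤ n * (I.K₀ / ε) := by
            rw [← mul_div_assoc, le_div_iff₀ hε]
            nlinarith [mul_le_mul hn1 le_rfl hK0.le (by positivity : (0 : ℝ) ≤ n)]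
          calc I.K₀ + S ≤ n * (I.K₀ / ε) + n * (I.K₀ / ε) := add_le_add this hS2
            _ = _ := by ring
        have h5 : v * L ≤ 2 * n * I.K₀ / ε / ε := by
          rw [le_div_iff₀ hε]
          linarith
        calc C ≤ (1 + 2 * ε) * (v * L) := hCle
          _ ≤ 3 * (2 * n * I.K₀ / ε / ε) := by
            refine mul_le_mul (by linarith) h5 (by positivity) (by norm_num)
          _ = _ := by field_simp; ring
      have h6 := h2.trans h3
      rw [le_div_iff₀ (by positivity)] at h6 ⊢
      have h7 : ε * I.K₀ / n * ((O i).card + 1) * ε ^ 2 =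
          I.K₀ / n * ((((O i).card : ℝ) + 1) * ε ^ 3) := by ring
      have h8 : 6 * n * I.K₀ = I.K₀ / n * (6 * n ^ 2) := by field_simp
      rw [h7, h8] at h6
      exact le_of_mul_le_mul_left h6 (by positivity)
    have hround : ∀ i, L ^ 2 / M ≤ ε * D i := fun i => by
      rw [div_le_iff₀ hM0']
      have h1 : 36 * (n : ℝ) ^ 3 / ε ^ 6 ≤ M := Nat.le_ceil _
      have h2 : 6 * (6 * (n : ℝ) ^ 2 / ε ^ 3) ≤ ε * (36 * (n : ℝ) ^ 3 / ε ^ 6) := by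
        have e1 : 6 * (6 * (n : ℝ) ^ 2 / ε ^ 3) = 36 * ((n : ℝ) ^ 2 * ε ^ 2) / ε ^ 5 := by
          field_simp; ring
        have e2 : ε * (36 * (n : ℝ) ^ 3 / ε ^ 6) = 36 * (n : ℝ) ^ 3 / ε ^ 5 := by
          field_simp
        rw [e1, e2]
        gcongr
        calc (n : ℝ) ^ 2 * ε ^ 2 ≤ (n : ℝ) ^ 2 * n := by
              gcongr
              exact (pow_le_one₀ hε.le hε1).trans hn1
          _ = _ := by ring
      have h3 : 2 * (((O i).card : ℝ) + 1) ≤ ε * M := by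
        have := mul_le_mul_of_nonneg_left h1 hε.le
        have := hN i
        have : (0 : ℝ) ≤ 6 * (n : ℝ) ^ 2 / ε ^ 3 := by positivity
        linarith
      calc L ^ 2 ≤ ((O i).card + 1) * (2 * D i) := hsq i
        _ = 2 * (((O i).card : ℝ) + 1) * D i := by ring
        _ ≤ ε * M * D i := mul_le_mul_of_nonneg_right h3 (hD0 i)
        _ = _ := by ring
    calc I.segCost R ≤ I.K₀ * ((Finset.univ.biUnion O).card + 1) +
          ∑ i, (I.K i * ((O i).card + 1) + 2 * I.H i * (D i + L ^ 2 / M)) := by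
          rw [← hba]; exact hR4
      _ ≤ (1 + ε) * C := by
          rw [hC, mul_add (1 + ε), Finset.mul_sum]
          refine add_le_add (le_mul_of_one_le_left (by positivity) (by linarith))
            (Finset.sum_le_sum fun i _ => ?_)
          have h1 := mul_le_mul_of_nonneg_left (hround i)
            (mul_nonneg zero_le_two (hI.H_pos i).le)
          have h2 : 0 ≤ ε * (I.K i * (((O i).card : ℝ) + 1)) := by
            have := hK i
            positivity
          linarith
      _ ≤ (1 + ε) * ((1 + 2 * ε) * (v * L)) := by gcongr
      -- Since `ε ≤ 1`, already `1 + 5 ε` would do.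
      _ ≤ (1 + 31 * ε) * (v * L) := by
          rw [← mul_assoc]
          gcongr
          nlinarith
      _ = _ := by ring

/-! ### The candidate lengths and the discrete-time instances -/

theorem Inst.lenLower_pos (hI : I.Valid) : 0 < I.lenLower :=
  div_pos hI.K₀_pos (mul_pos (by norm_num) (Inst.bigM_pos hI))

theorem Inst.lenUpper_div_lenLower (hI : I.Valid) :
    I.lenUpper ε / I.lenLower = 256 * I.bigM ^ 2 / (ε ^ 2 * I.K₀ * I.Hmin) := by
  have := hI.K₀_pos
  have := Inst.bigM_pos hI
  unfold Inst.lenUpper Inst.lenLower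
  field_simp
  norm_num

/-- The logarithm of the ratio is thus at least `2`, which absorbs the rounding up and the `+ 1` in
the number of candidates. -/
theorem Inst.exp_two_le_ratio [Nonempty ι] (hI : I.Valid) (hε : 0 < ε) (hε1 : ε ≤ 1) :
    Real.exp 2 ≤ 256 * I.bigM ^ 2 / (ε ^ 2 * I.K₀ * I.Hmin) := by
  have hK0 := hI.K₀_pos
  have hB := Inst.bigM_pos hI
  have hHm := Inst.Hmin_pos hI
  obtain ⟨i⟩ := ‹Nonempty ι›
  have hle := Inst.add_le_bigM hI i
  have hHi := I.Hmin_le i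
  have hKi := hI.K_nonneg i
  rw [le_div_iff₀ (by positivity)]
  have h1 : ε ^ 2 * I.K₀ * I.Hmin ≤ I.bigM ^ 2 := by
    calc ε ^ 2 * I.K₀ * I.Hmin ≤ 1 * I.bigM * I.bigM := by
          gcongr
          · exact pow_le_one₀ hε.le hε1
          · linarith [hI.H_pos i]
          · linarith
      _ = _ := by ring
  have h2 : Real.exp 2 ≤ 256 := by
    have : Real.exp 2 = Real.exp 1 ^ 2 := by rw [← Real.exp_nat_mul]; norm_num
    rw [this]
    nlinarith [Real.exp_one_lt_d9, Real.exp_pos 1]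
  exact mul_le_mul h2 h1 (by positivity) (by norm_num)

theorem Inst.card_candidates_le [Nonempty ι] (hI : I.Valid) (hε : 0 < ε) (hε1 : ε ≤ 1) :
    ((I.candidates ε).card : ℝ) ≤
      3 / ε * Real.log (256 * I.bigM ^ 2 / (ε ^ 2 * I.K₀ * I.Hmin)) := by
  have hexp := Inst.exp_two_le_ratio hI hε hε1
  have hcard : ((I.candidates ε).card : ℝ) ≤
      ⌈Real.logb (1 + ε) (I.lenUpper ε / I.lenLower)⌉₊ + 1 := by
    have : (I.candidates ε).card ≤ ⌈Real.logb (1 + ε) (I.lenUpper ε / I.lenLower)⌉₊ + 1 :=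
      Finset.card_image_le.trans_eq (Finset.card_range _)
    exact_mod_cast this
  rw [Inst.lenUpper_div_lenLower hI] at hcard
  set R := 256 * I.bigM ^ 2 / (ε ^ 2 * I.K₀ * I.Hmin) with hR
  have hlog : 2 ≤ Real.log R := by
    rwa [Real.le_log_iff_exp_le ((Real.exp_pos 2).trans_le hexp)]
  have hlog1 : ε / 2 ≤ Real.log (1 + ε) := by
    refine le_trans ?_ (Real.one_sub_inv_le_log_of_pos (by linarith))
    have : 1 - (1 + ε)⁻¹ = ε / (1 + ε) := by field_simp; ring
    rw [this]
    gcongr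
    linarith
  have h1 : Real.logb (1 + ε) R ≤ 2 / ε * Real.log R := by
    unfold Real.logb
    rw [div_le_iff₀ (by linarith)]
    calc Real.log R = 2 / ε * Real.log R * (ε / 2) := by field_simp
      _ ≤ _ := by gcongr
  have h2 : (⌈Real.logb (1 + ε) R⌉₊ : ℝ) < Real.logb (1 + ε) R + 1 :=
    Nat.ceil_lt_add_one (div_nonneg (by linarith) (by linarith))
  have h3 : 2 ≤ 1 / ε * Real.log R := by
    have : 1 ≤ 1 / ε := by rwa [le_div_iff₀ hε, one_mul]
    nlinarith
  have h4 : 3 / ε * Real.log R = 2 / ε * Real.log R + 1 / ε * Real.log R := by ring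
  linarith

/-- The first candidate that reaches `L` works: its predecessor is below `L`, or it is `lenLower ≤
L` itself. -/
theorem Inst.exists_candidate (hI : I.Valid) (hε : 0 < ε) {L : ℝ}
    (h1 : I.lenLower ≤ L) (h2 : L ≤ I.lenUpper ε) :
    ∃ l ∈ I.candidates ε, L ≤ l ∧ l ≤ (1 + ε) * L := by
  have hl := Inst.lenLower_pos hI
  set N := ⌈Real.logb (1 + ε) (I.lenUpper ε / I.lenLower)⌉₊ with hN
  have hratio : 0 < I.lenUpper ε / I.lenLower := div_pos (by linarith) hl
  have hNspec : L ≤ I.lenLower * (1 + ε) ^ N := by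
    refine h2.trans ?_
    rw [← div_le_iff₀' hl]
    calc I.lenUpper ε / I.lenLower
        = (1 + ε) ^ Real.logb (1 + ε) (I.lenUpper ε / I.lenLower) :=
          (Real.rpow_logb (by linarith) (by linarith) hratio).symm
      _ ≤ (1 + ε) ^ (N : ℝ) := Real.rpow_le_rpow_of_exponent_le (by linarith) (Nat.le_ceil _)
      _ = _ := Real.rpow_natCast _ _
  classical
  have hex : ∃ k, L ≤ I.lenLower * (1 + ε) ^ k := ⟨N, hNspec⟩
  refine ⟨I.lenLower * (1 + ε) ^ Nat.find hex, ?_, Nat.find_spec hex, ?_⟩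
  · refine Finset.mem_image.2 ⟨Nat.find hex, Finset.mem_range.2 ?_, rfl⟩
    exact Nat.lt_succ_of_le (Nat.find_min' hex hNspec)
  · rcases Nat.eq_zero_or_pos (Nat.find hex) with h0 | h0
    · rw [h0, pow_zero, mul_one]
      nlinarith
    · have h3 := Nat.find_min hex (m := Nat.find hex - 1) (by omega)
      rw [not_le] at h3
      calc I.lenLower * (1 + ε) ^ Nat.find hex
          = (1 + ε) * (I.lenLower * (1 + ε) ^ (Nat.find hex - 1)) := by
            conv_lhs => rw [← Nat.sub_add_cancel h0, pow_succ]
            ring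
        _ ≤ _ := by gcongr

/-! ### Affine rescaling of a segment to `[0, M)` -/

/-- The image of a policy on `[a, b)` under the affine map which takes `[a, b)` to `[0, M)`. -/
def SegPolicy.rescale {a b : ℝ} (P : SegPolicy a b) (M : ℕ) {d : ℝ} (hd : 0 < d)
    (hdM : d * M = b - a) : SegPolicy 0 (M : ℝ) where
  orders := P.orders.image fun s => (s - a) / d
  q := fun x => P.q (a + d * x) / d
  orders_mem := by
    intro t ht
    obtain ⟨s, hs, rfl⟩ := Finset.mem_image.1 ht
    obtain ⟨h1, h2⟩ := P.orders_mem s hs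
    refine ⟨div_nonneg (by linarith) hd.le, ?_⟩
    rw [div_lt_iff₀ hd]
    linarith

section
variable {a b : ℝ} (P : SegPolicy a b) {M : ℕ} {d : ℝ} (hd : 0 < d) (hdM : d * M = b - a)

theorem affine_injective (a : ℝ) (hd : 0 < d) : Function.Injective fun s => (s - a) / d :=
  fun x y h => by
    simp only at h
    rw [div_left_inj' hd.ne'] at h
    linarith

theorem SegPolicy.rescale_inventory (x : ℝ) :
    (P.rescale M hd hdM).inventory x = P.inventory (a + d * x) / d := by
  simp only [SegPolicy.inventory, SegPolicy.rescale]
  rw [Finset.filter_image, Finset.sum_image fun x _ y _ h => affine_injective a hd h]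
  have h1 : ∀ s, a + d * ((s - a) / d) = s := fun s => by field_simp; ring
  simp only [h1, ← Finset.sum_div]
  have h2 : P.orders.filter (fun s => (s - a) / d ≤ x) = P.orders.filter (· ≤ a + d * x) := by
    refine Finset.filter_congr fun s _ => ?_
    rw [div_le_iff₀ hd]
    constructor <;> intro h <;> linarith
  rw [h2]
  field_simp
  ring

theorem SegPolicy.Feasible.rescale (hP : P.Feasible) : (P.rescale M hd hdM).Feasible := by
  intro x hx
  rw [SegPolicy.rescale_inventory]
  refine div_nonneg (hP _ ⟨?_, ?_⟩) hd.le
  · nlinarith [hx.1]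
  · nlinarith [hx.2]

theorem SegPolicy.EndsEmpty.rescale (hP : P.EndsEmpty) : (P.rescale M hd hdM).EndsEmpty := by
  simp only [SegPolicy.EndsEmpty, SegPolicy.rescale] at hP ⊢
  rw [Finset.sum_image fun x _ y _ h => affine_injective a hd h]
  have h1 : ∀ s, a + d * ((s - a) / d) = s := fun s => by field_simp; ring
  simp only [h1, ← Finset.sum_div]
  rw [hP, ← hdM]
  field_simp
  simp

theorem SegPolicy.integral_rescale :
    ∫ x in Set.Ico 0 (M : ℝ), (P.rescale M hd hdM).inventory x =
      (∫ t in Set.Ico a b, P.inventory t) / d ^ 2 := by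
  have hab : a ≤ b := by nlinarith [Nat.cast_nonneg (α := ℝ) M]
  simp only [SegPolicy.rescale_inventory]
  rw [setIntegral_Ico_eq (Nat.cast_nonneg M), setIntegral_Ico_eq hab,
    intervalIntegral.integral_div]
  have := intervalIntegral.integral_comp_mul_add (a := 0) (b := (M : ℝ)) P.inventory hd.ne' a
  simp only [add_comm a]
  rw [this, smul_eq_mul, mul_zero, zero_add, hdM, sub_add_cancel]
  field_simp

theorem card_biUnion_rescale {ι : Type*} [Fintype ι] (P : ι → SegPolicy a b) :
    (Finset.univ.biUnion fun i => ((P i).rescale M hd hdM).orders).card =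
      (Finset.univ.biUnion fun i => (P i).orders).card := by
  simp only [SegPolicy.rescale]
  rw [← Finset.biUnion_image, Finset.card_image_of_injective _ (affine_injective a hd)]

theorem SegPolicy.card_rescale : (P.rescale M hd hdM).orders.card = P.orders.card :=
  Finset.card_image_of_injective _ (affine_injective a hd)

end

/-- The segment of length `b - a` is stretched to a candidate length `l` between `b - a` and `(1 +
ε) (b - a)`. -/
theorem Inst.exists_discrete_policy [Nonempty ι] (hI : I.Valid) (hε : 0 < ε) (hε1 : ε ≤ 1)
    (hreg : I.Regular ε) :
    ∃ l ∈ I.candidates ε, ∃ P : DiscretePolicy ι (numPeriods (Fintype.card ι) ε),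
      P.Admissible ∧ (∀ i, (P i).EndsEmpty) ∧
      ENNReal.ofReal ((I.discretize (l / numPeriods (Fintype.card ι) ε)).segCost P / l) ≤
        ENNReal.ofReal ((1 + ε) * (1 + 31 * ε)) * I.opt := by
  obtain ⟨a, b, -, hab, hlo, hup, P, hP1, hP2, hP3, hP4⟩ := Inst.exists_segment hI hε hε1 hreg
  obtain ⟨l, hl, hLl, hlL⟩ := Inst.exists_candidate hI hε hlo hup
  set M := numPeriods (Fintype.card ι) ε with hM
  have hM0 : (0 : ℝ) < M := by exact_mod_cast numPeriods_pos Fintype.card_pos hε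
  have hL : 0 < b - a := sub_pos.2 hab
  have hl0 : 0 < l := hL.trans_le hLl
  have hd : 0 < (b - a) / M := by positivity
  have hdM : (b - a) / M * M = b - a := by field_simp
  refine ⟨l, hl, fun i => (P i).rescale M hd hdM, ⟨fun i => (hP1 i).rescale _ hd hdM, ?_⟩,
    fun i => (hP2 i).rescale _ hd hdM, ?_⟩
  · intro i t ht
    obtain ⟨s, hs, rfl⟩ := Finset.mem_image.1 ht
    obtain ⟨k, -, hk⟩ := Finset.mem_image.1 (Finset.mem_coe.1 (hP3 i s hs))
    refine ⟨k, ?_⟩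
    simp only
    rw [← hk]
    field_simp
    ring
  · rw [ENNReal.ofReal_mul (by linarith), mul_assoc]
    refine le_trans ?_ (mul_le_mul_right hP4 _)
    rw [← ENNReal.ofReal_mul (by linarith)]
    refine ENNReal.ofReal_le_ofReal ?_
    have hK := hI.K_nonneg
    have hH := fun i => (hI.H_pos i).le
    have hK0 := hI.K₀_pos.le
    have hJ := fun i => SegPolicy.integral_inventory_nonneg (hP1 i)
    simp only [Inst.segCost, Inst.discretize, SegPolicy.integral_rescale, SegPolicy.card_rescale,
      card_biUnion_rescale]
    set A := I.K₀ * ((Finset.univ.biUnion fun i => (P i).orders).card : ℝ) with hA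
    set J := fun i => ∫ t in Set.Ico a b, (P i).inventory t with hJdef
    have hord : ∀ x : ℝ, 0 ≤ x → x / l ≤ (1 + ε) * (x / (b - a)) := fun x hx =>
      (div_le_div_of_nonneg_left hx hL hLl).trans
        (le_mul_of_one_le_left (by positivity) (by linarith))
    -- Holding cost is quadratic in the length, so per unit of time it grows by `l / (b - a) ≤ 1 +
    -- ε`.
    have hhold : ∀ i, 2 * (I.H i * (l / M) ^ 2) * (J i / ((b - a) / M) ^ 2) / l ≤
        (1 + ε) * (2 * I.H i * J i / (b - a)) := fun i => by
      have e : 2 * (I.H i * (l / M) ^ 2) * (J i / ((b - a) / M) ^ 2) / l =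
          l / (b - a) * (2 * I.H i * J i / (b - a)) := by
        field_simp
      rw [e]
      have := hH i
      have : 0 ≤ J i := hJ i
      gcongr
      rwa [div_le_iff₀ hL]
    rw [add_div, add_div, mul_add, Finset.sum_div, Finset.sum_div, Finset.mul_sum]
    refine add_le_add (hord _ (by positivity)) (Finset.sum_le_sum fun i _ => ?_)
    rw [add_div, add_div, mul_add]
    exact add_le_add (hord _ (mul_nonneg (hK i) (by positivity))) (hhold i)

end

end JointReplenishment

end

open JointReplenishment
theorem lemma5 {ι : Type*} [Fintype ι] [Nonempty ι] (I : Inst ι) (hI : I.Valid)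
    (ε : ℝ) (hε : 0 < ε) (hε1 : ε ≤ 1) :
    -- instances without expensive and cheap items
    (I.Regular ε →
      -- a segment, a grid in it, and a grid-restricted policy
      (∃ a b : ℝ, 0 ≤ a ∧ a < b ∧ I.lenLower ≤ b - a ∧ b - a ≤ I.lenUpper ε ∧
        ∃ M : ℕ, M = numPeriods (Fintype.card ι) ε ∧ 0 < M ∧
          ((grid a b M).card : ℝ) ≤ 38 * (Fintype.card ι : ℝ) ^ 3 / ε ^ 6 ∧
          ∃ P : ι → SegPolicy a b,
            (∀ i, (P i).Feasible) ∧ (∀ i, (P i).EndsEmpty) ∧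
            Restricted (grid a b M : Set ℝ) P ∧
            ENNReal.ofReal (I.segCost P / (b - a)) ≤ ENNReal.ofReal (1 + 31 * ε) * I.opt) ∧
      -- reduction to discrete time: number of candidate lengths, and number of periods
      ((I.candidates ε).card : ℝ) ≤
        3 / ε * Real.log (256 * I.bigM ^ 2 / (ε ^ 2 * I.K₀ * I.Hmin)) ∧
      (numPeriods (Fintype.card ι) ε : ℝ) ≤ 37 * (Fintype.card ι : ℝ) ^ 3 / ε ^ 6 ∧
      -- for one of the candidate lengths, the discrete-time instance has a cheap policy
      (∃ l ∈ I.candidates ε, ∃ P : DiscretePolicy ι (numPeriods (Fintype.card ι) ε),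
        P.Admissible ∧ (∀ i, (P i).EndsEmpty) ∧
        ENNReal.ofReal
            ((I.discretize (l / numPeriods (Fintype.card ι) ε)).segCost P / l) ≤
          ENNReal.ofReal ((1 + ε) * (1 + 31 * ε)) * I.opt) ∧
      -- any discrete-time policy gives an infinite-horizon policy that costs no more
      (∀ l : ℝ, 0 < l → ∀ P : DiscretePolicy ι (numPeriods (Fintype.card ι) ε),
        P.Admissible →
        ∃ Q : ι → Policy, (∀ i, (Q i).Feasible) ∧
          I.longRunCost Q ≤ ENNReal.ofReal
            ((I.discretize (l / numPeriods (Fintype.card ι) ε)).segCost P / l))) ∧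
    -- arbitrary instances: reduction to those without expensive and cheap items
    ((I.reduced ε).Valid ∧ (I.reduced ε).Regular ε ∧
      (I.reduced ε).opt + ENNReal.ofReal (I.expensiveCost ε) ≤
        ENNReal.ofReal (1 + 2 * ε) * I.opt ∧
      (∀ P : I.Kept ε → Policy, (∀ i, (P i).Feasible) →
        ∃ Q : ι → Policy, (∀ i, (Q i).Feasible) ∧
          I.longRunCost Q ≤
            (I.reduced ε).longRunCost P + ENNReal.ofReal (I.expensiveCost ε))) := by
  have hn : 0 < Fintype.card ι := Fintype.card_pos
  refine ⟨fun hreg => ⟨?_, Inst.card_candidates_le hI hε hε1, numPeriods_le hn hε hε1,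
    Inst.exists_discrete_policy hI hε hε1 hreg,
    fun l hl P hP => Inst.exists_longRunCost_le hI (numPeriods_pos hn hε) hl P hP⟩,
    Inst.reduced_valid hI, Inst.reduced_regular hI hε hε1, Inst.reduced_opt_add_le hI hε,
    Inst.exists_extension hI hε⟩
  obtain ⟨a, b, ha, hab, hlo, hup, P, hP⟩ := Inst.exists_segment hI hε hε1 hreg
  exact ⟨a, b, ha, hab, hlo, hup, _, rfl, numPeriods_pos hn hε, card_grid_le hn hε hε1 a b, P, hP⟩
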